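/- Let $q\in\mathbb C\setminus\{0\}$ and let $n\ge 1$ be an integer such that the quantum integer $1+q^2+q^4+\dots+q^{2n}$ is nonzero (equivalently, $q^2=1$ or $q^{2(n+1)}\neq 1$; for instance, $q$ is not a root of unity). Let $\mathbb C[X,Y]^q$ be the $\mathbb C$-algebra with generators $X,Y$ and relation $YX=qXY$, and let $\mathbb C[X,Y]^q_k$ be the span of the monomials $X^iY^j$ with $i+j=k$. For a unital associative $\mathbb C$-algebra $\mathcal A$, let $\mathcal A[X,Y]^q=\mathcal A\otimes_{\mathbb C}\mathbb C[X,Y]^q$ and $\mathcal A[X,Y]^q_k=\mathcal A\otimes_{\mathbb C}\mathbb C[X,Y]^q_k$. An $\mathcal A$-point of $\mathrm{SL}_2^q$ is a matrix $A=\begin{pmatrix}a&b\\c&d\end{pmatrix}$ with entries in $\mathcal A$ such that $$ba=qab,\quad db=qbd,\quad bc=cb,\quad ca=qac,\quad dc=qcd,\quad ad-q^{-1}bc=da-qbc=1;$$ $\mathrm{SL}_2^q(\mathcal A)$ denotes the set of these. Let $\rho(A)$ be the left $\mathcal A$-linear endomorphism of $\mathcal A[X,Y]^q$ that sends $\sum_{i,j}a_{ij}X^iY^j$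 to $\sum_{i,j}a_{ij}(aX+bY)^i(cX+dY)^j$. It preserves each $\mathcal A[X,Y]^q_k$; let $\rho_k(A)$ be its restriction. Finally, $\rho_1(A)\otimes_{\mathcal A}\rho_n(A)$ is the left $\mathcal A$-linear endomorphism of $\mathcal A[X,Y]^q_1\otimes_{\mathcal A}\mathcal A[X,Y]^q_n$ determined by $P\otimes Q\mapsto\rho_1(A)(P)\otimes\rho_n(A)(Q)$ for $P\in\mathbb C[X,Y]^q_1$ and $Q\in\mathbb C[X,Y]^q_n$. Then there is a $\mathbb C$-linear isomorphism $$\phi\colon \mathbb C[X,Y]^q_1\otimes_{\mathbb C}\mathbb C[X,Y]^q_n\longrightarrow \mathbb C[X,Y]^q_{n+1}\oplus\mathbb C[X,Y]^q_{n-1}$$ such that, for every unital associative $\mathbb C$-algebra $\mathcal A$ and every $A\in\mathrm{SL}_2^q(\mathcal A)$, the induced $\mathcal A$-linear isomorphism $$\mathrm{Id}_{\mathcal A}\otimes\phi\colon\mathcal A[X,Y]^q_1\otimes_{\mathcal A}\mathcal A[X,Y]^q_n\longrightarrow\mathcal A[X,Y]^q_{n+1}\oplus\mathcal A[X,Y]^q_{n-1}$$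 satisfies $$(\mathrm{Id}_{\mathcal A}\otimes\phi)\circ\big(\rho_1(A)\otimes_{\mathcal A}\rho_n(A)\big)=\big(\rho_{n+1}(A)\oplus\rho_{n-1}(A)\big)\circ(\mathrm{Id}_{\mathcal A}\otimes\phi).$$ -/

import Mathlib

open scoped TensorProduct

noncomputable section

namespace QuantumSL2

/-- The single relation `Y X = q X Y` between the generators `X = ι 0` and `Y = ι 1`. -/
inductive PlaneRel (q : ℂˣ) : FreeAlgebra ℂ (Fin 2) → FreeAlgebra ℂ (Fin 2) → Prop
  | comm : PlaneRel q (FreeAlgebra.ι ℂ 1 * FreeAlgebra.ι ℂ 0)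
      ((q : ℂ) • (FreeAlgebra.ι ℂ 0 * FreeAlgebra.ι ℂ 1))

/-- The quantum plane `ℂ[X,Y]^q`: the `ℂ`-algebra with generators `X`, `Y`
and relation `Y X = q X Y`. -/
def Plane (q : ℂˣ) : Type := RingQuot (PlaneRel q)

instance (q : ℂˣ) : Ring (Plane q) := inferInstanceAs (Ring (RingQuot (PlaneRel q)))

instance (q : ℂˣ) : Algebra ℂ (Plane q) := inferInstanceAs (Algebra ℂ (RingQuot (PlaneRel q)))

/-- The generator `X` of the quantum plane. -/
def planeX (q : ℂˣ) : Plane q := RingQuot.mkAlgHom ℂ (PlaneRel q) (FreeAlgebra.ι ℂ 0)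

/-- The generator `Y` of the quantum plane. -/
def planeY (q : ℂˣ) : Plane q := RingQuot.mkAlgHom ℂ (PlaneRel q) (FreeAlgebra.ι ℂ 1)

theorem planeY_mul_planeX (q : ℂˣ) : planeY q * planeX q = (q : ℂ) • (planeX q * planeY q) := by
  have h := RingQuot.mkAlgHom_rel ℂ (PlaneRel.comm (q := q))
  rw [map_smul, map_mul, map_mul] at h
  exact h

/-- The space `ℂ[X,Y]^q_n` of homogeneous polynomials of degree `n`, spanned by the
monomials `X^i Y^j` with `i + j = n`. -/
def planeHom (q : ℂˣ) (n : ℕ) : Submodule ℂ (Plane q) :=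
  Submodule.span ℂ {P | ∃ i j : ℕ, i + j = n ∧ P = planeX q ^ i * planeY q ^ j}

/-- `ℂ[X,Y]^q_n` as a vector space on its own. -/
def PlaneHom (q : ℂˣ) (n : ℕ) : Type := planeHom q n

instance (q : ℂˣ) (n : ℕ) : AddCommGroup (PlaneHom q n) :=
  inferInstanceAs (AddCommGroup (planeHom q n))

instance (q : ℂˣ) (n : ℕ) : Module ℂ (PlaneHom q n) :=
  inferInstanceAs (Module ℂ (planeHom q n))

/-- The inclusion of `ℂ[X,Y]^q_n` in `ℂ[X,Y]^q`. -/
def planeIncl (q : ℂˣ) (n : ℕ) : PlaneHom q n →ₗ[ℂ] Plane q := (planeHom q n).subtype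

theorem planeIncl_injective (q : ℂˣ) (n : ℕ) : Function.Injective (planeIncl q n) :=
  (planeHom q n).injective_subtype

theorem planeIncl_mem (q : ℂˣ) (n : ℕ) (P : PlaneHom q n) : planeIncl q n P ∈ planeHom q n := P.2

theorem planeY_pow_mul_planeX (q : ℂˣ) (j : ℕ) :
    planeY q ^ j * planeX q = (q : ℂ) ^ j • (planeX q * planeY q ^ j) := by
  induction j with
  | zero => simp
  | succ j ih =>
    rw [pow_succ, mul_assoc, planeY_mul_planeX, mul_smul_comm, ← mul_assoc, ih, smul_mul_assoc,
      smul_smul, mul_assoc, pow_succ, mul_comm (q : ℂ)]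

theorem mul_planeX_mem (q : ℂˣ) {n : ℕ} {P : Plane q} (hP : P ∈ planeHom q n) :
    P * planeX q ∈ planeHom q (n + 1) := by
  induction hP using Submodule.span_induction with
  | mem P h =>
    obtain ⟨i, j, rfl, rfl⟩ := h
    rw [mul_assoc, planeY_pow_mul_planeX, mul_smul_comm, ← mul_assoc, ← pow_succ]
    exact Submodule.smul_mem _ _ (Submodule.subset_span ⟨i + 1, j, by omega, rfl⟩)
  | zero => simp
  | add P Q _ _ hP hQ => rw [add_mul]; exact Submodule.add_mem _ hP hQ
  | smul r P _ hP => rw [smul_mul_assoc]; exact Submodule.smul_mem _ _ hP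

theorem mul_planeY_mem (q : ℂˣ) {n : ℕ} {P : Plane q} (hP : P ∈ planeHom q n) :
    P * planeY q ∈ planeHom q (n + 1) := by
  induction hP using Submodule.span_induction with
  | mem P h =>
    obtain ⟨i, j, rfl, rfl⟩ := h
    rw [mul_assoc, ← pow_succ]
    exact Submodule.subset_span ⟨i, j + 1, by omega, rfl⟩
  | zero => simp
  | add P Q _ _ hP hQ => rw [add_mul]; exact Submodule.add_mem _ hP hQ
  | smul r P _ hP => rw [smul_mul_assoc]; exact Submodule.smul_mem _ _ hP

/-- The `𝒜`-points of `SL₂^q`: the 2-by-2 matrices `(a b; c d)` with entries in the `ℂ`-algebra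
`𝒜` that satisfy the relations of `SL₂^q`. -/
structure Point (q : ℂˣ) (𝒜 : Type*) [Ring 𝒜] [Algebra ℂ 𝒜] where
  (a b c d : 𝒜)
  ba : b * a = (q : ℂ) • (a * b)
  db : d * b = (q : ℂ) • (b * d)
  bc : b * c = c * b
  ca : c * a = (q : ℂ) • (a * c)
  dc : d * c = (q : ℂ) • (c * d)
  ad_da : a * d - (q : ℂ)⁻¹ • (b * c) = d * a - (q : ℂ) • (b * c)
  det : a * d - (q : ℂ)⁻¹ • (b * c) = 1

variable {q : ℂˣ} {𝒜 : Type*} [Ring 𝒜] [Algebra ℂ 𝒜]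

/-- `aX + bY`, as an element of the quantum `𝒜`-plane `𝒜[X,Y]^q = 𝒜 ⊗ ℂ[X,Y]^q`. -/
def Point.imX (A : Point q 𝒜) : 𝒜 ⊗[ℂ] Plane q := A.a ⊗ₜ planeX q + A.b ⊗ₜ planeY q

/-- `cX + dY`, as an element of the quantum `𝒜`-plane `𝒜[X,Y]^q = 𝒜 ⊗ ℂ[X,Y]^q`. -/
def Point.imY (A : Point q 𝒜) : 𝒜 ⊗[ℂ] Plane q := A.c ⊗ₜ planeX q + A.d ⊗ₜ planeY q

theorem Point.imY_mul_imX (A : Point q 𝒜) : A.imY * A.imX = (q : ℂ) • (A.imX * A.imY) := by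
  have hda : A.d * A.a = A.a * A.d - (q : ℂ)⁻¹ • (A.b * A.c) + (q : ℂ) • (A.b * A.c) := by
    rw [A.ad_da]; abel
  simp only [Point.imX, Point.imY, add_mul, mul_add, Algebra.TensorProduct.tmul_mul_tmul,
    planeY_mul_planeX, A.ca, A.db, hda, A.bc, TensorProduct.tmul_smul, TensorProduct.smul_tmul',
    TensorProduct.add_tmul, TensorProduct.sub_tmul, smul_add, smul_sub, smul_smul,
    mul_inv_cancel₀ q.ne_zero, one_smul]
  abel

/-- The algebra homomorphism `ℂ[X,Y]^q → 𝒜[X,Y]^q` that sends `P(X,Y)` to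
`P(aX + bY, cX + dY)`. -/
def Point.subst (A : Point q 𝒜) : Plane q →ₐ[ℂ] 𝒜 ⊗[ℂ] Plane q :=
  RingQuot.liftAlgHom ℂ ⟨FreeAlgebra.lift ℂ ![A.imX, A.imY], by
    rintro _ _ ⟨⟩
    simpa using A.imY_mul_imX⟩

/-- The action `ρ(A)` on `𝒜[X,Y]^q = 𝒜 ⊗ ℂ[X,Y]^q`: the (left) `𝒜`-linear map that sends
`∑ aᵢⱼ X^i Y^j` to `∑ aᵢⱼ (aX + bY)^i (cX + dY)^j`. -/
def Point.rho (A : Point q 𝒜) : 𝒜 ⊗[ℂ] Plane q →ₗ[𝒜] 𝒜 ⊗[ℂ] Plane q :=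
  TensorProduct.AlgebraTensorModule.lift
    (LinearMap.toSpanSingleton 𝒜 (Plane q →ₗ[ℂ] 𝒜 ⊗[ℂ] Plane q) A.subst.toLinearMap)

theorem Point.rho_tmul (A : Point q 𝒜) (x : 𝒜) (P : Plane q) :
    A.rho (x ⊗ₜ P) = x • A.subst P := rfl

theorem Point.subst_X (A : Point q 𝒜) : A.subst (planeX q) = A.imX := by
  refine (RingQuot.liftAlgHom_mkAlgHom_apply ℂ (FreeAlgebra.lift ℂ ![A.imX, A.imY]) _ _).trans ?_
  simp

theorem Point.subst_Y (A : Point q 𝒜) : A.subst (planeY q) = A.imY := by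
  refine (RingQuot.liftAlgHom_mkAlgHom_apply ℂ (FreeAlgebra.lift ℂ ![A.imX, A.imY]) _ _).trans ?_
  simp

/-- The formula that defines `ρ(A)`. -/
theorem Point.rho_monomial (A : Point q 𝒜) (x : 𝒜) (i j : ℕ) :
    A.rho (x ⊗ₜ (planeX q ^ i * planeY q ^ j)) = x • (A.imX ^ i * A.imY ^ j) := by
  rw [A.rho_tmul, map_mul, map_pow, map_pow, A.subst_X, A.subst_Y]

variable (q 𝒜) in
/-- The space `𝒜[X,Y]^q_n = 𝒜 ⊗ ℂ[X,Y]^q_n`. -/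
abbrev HomPart (n : ℕ) : Type _ := 𝒜 ⊗[ℂ] PlaneHom q n

variable (q 𝒜) in
/-- The inclusion of `𝒜[X,Y]^q_n` in `𝒜[X,Y]^q`. -/
def homIncl (n : ℕ) : HomPart q 𝒜 n →ₗ[𝒜] 𝒜 ⊗[ℂ] Plane q := (planeIncl q n).baseChange 𝒜

theorem homIncl_tmul (n : ℕ) (x : 𝒜) (P : PlaneHom q n) :
    homIncl q 𝒜 n (x ⊗ₜ P) = x ⊗ₜ planeIncl q n P := rfl

variable (q 𝒜) in
theorem homIncl_injective (n : ℕ) : Function.Injective (homIncl q 𝒜 n) :=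
  Module.Flat.lTensor_preserves_injective_linearMap (M := 𝒜) _ (planeIncl_injective q n)

theorem tmul_mem (x : 𝒜) {n : ℕ} {P : Plane q} (hP : P ∈ planeHom q n) :
    x ⊗ₜ[ℂ] P ∈ LinearMap.range (homIncl q 𝒜 n) := ⟨x ⊗ₜ (⟨P, hP⟩ : planeHom q n), rfl⟩

theorem mul_linear_mem (n : ℕ) (x y : 𝒜) {P : 𝒜 ⊗[ℂ] Plane q}
    (hP : P ∈ LinearMap.range (homIncl q 𝒜 n)) :
    P * (x ⊗ₜ planeX q + y ⊗ₜ planeY q) ∈ LinearMap.range (homIncl q 𝒜 (n + 1)) := by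
  obtain ⟨t, rfl⟩ := hP
  induction t using TensorProduct.induction_on with
  | zero => simp
  | tmul z v =>
    rw [homIncl_tmul, mul_add, Algebra.TensorProduct.tmul_mul_tmul,
      Algebra.TensorProduct.tmul_mul_tmul]
    exact Submodule.add_mem _
      (tmul_mem _ (mul_planeX_mem q (planeIncl_mem q n v)))
      (tmul_mem _ (mul_planeY_mem q (planeIncl_mem q n v)))
  | add s t hs ht => rw [map_add, add_mul]; exact Submodule.add_mem _ hs ht

theorem Point.monomial_mem (A : Point q 𝒜) (i j : ℕ) :
    A.imX ^ i * A.imY ^ j ∈ LinearMap.range (homIncl q 𝒜 (i + j)) := by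
  induction j with
  | zero =>
    rw [pow_zero, mul_one]
    induction i with
    | zero =>
      exact tmul_mem (1 : 𝒜)
        (Submodule.subset_span ⟨0, 0, rfl, by simp⟩)
    | succ i ih =>
      rw [pow_succ, add_zero]
      exact mul_linear_mem i _ _ ih
  | succ j ih =>
    rw [pow_succ, ← mul_assoc]
    exact mul_linear_mem (i + j) _ _ ih

/-- `ρ(A)` respects the homogeneous part `𝒜[X,Y]^q_n` of `𝒜[X,Y]^q`. -/
theorem Point.rho_mem (A : Point q 𝒜) (n : ℕ) (P : 𝒜 ⊗[ℂ] Plane q)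
    (hP : P ∈ LinearMap.range (homIncl q 𝒜 n)) : A.rho P ∈ LinearMap.range (homIncl q 𝒜 n) := by
  obtain ⟨t, rfl⟩ := hP
  induction t using TensorProduct.induction_on with
  | zero => simp
  | tmul z v =>
    rw [homIncl_tmul, A.rho_tmul]
    refine Submodule.smul_mem _ _ ?_
    have hv := planeIncl_mem q n v
    generalize planeIncl q n v = P at hv
    induction hv using Submodule.span_induction with
    | mem P h =>
      obtain ⟨i, j, rfl, rfl⟩ := h
      rw [map_mul, map_pow, map_pow, A.subst_X, A.subst_Y]
      exact A.monomial_mem i j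
    | zero => simp
    | add P Q _ _ hP hQ => rw [map_add]; exact Submodule.add_mem _ hP hQ
    | smul r P _ hP => rw [map_smul]; exact Submodule.smul_of_tower_mem _ r hP
  | add s t hs ht => rw [map_add, map_add]; exact Submodule.add_mem _ hs ht

variable (q 𝒜) in
/-- `𝒜 ⊗ ℂ[X,Y]^q_n` is identified with its image in `𝒜 ⊗ ℂ[X,Y]^q`. -/
def homPartEquiv (n : ℕ) : HomPart q 𝒜 n ≃ₗ[𝒜] LinearMap.range (homIncl q 𝒜 n) :=
  LinearEquiv.ofInjective (homIncl q 𝒜 n) (homIncl_injective q 𝒜 n)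

/-- The restriction `ρ_n(A)` of `ρ(A)` to `𝒜[X,Y]^q_n`. -/
def Point.rhoHom (A : Point q 𝒜) (n : ℕ) : HomPart q 𝒜 n →ₗ[𝒜] HomPart q 𝒜 n :=
  (homPartEquiv q 𝒜 n).symm.toLinearMap ∘ₗ
    (A.rho.restrict (A.rho_mem n) ∘ₗ (homPartEquiv q 𝒜 n).toLinearMap)

theorem Point.coe_rhoHom (A : Point q 𝒜) (n : ℕ) (P : HomPart q 𝒜 n) :
    homIncl q 𝒜 n (A.rhoHom n P) =
      A.rho (homIncl q 𝒜 n P) := by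
  have h : homPartEquiv q 𝒜 n (A.rhoHom n P) =
      A.rho.restrict (A.rho_mem n) (homPartEquiv q 𝒜 n P) := by
    simp [Point.rhoHom]
  exact congrArg Subtype.val h

section Balanced

variable (𝒜) (M N : Type*) [AddCommGroup M] [Module ℂ M] [Module 𝒜 M] [IsScalarTower ℂ 𝒜 M]
  [Module 𝒜ᵐᵒᵖ M] [AddCommGroup N] [Module ℂ N] [Module 𝒜 N]

/-- The relations `(m·x) ⊗ n = m ⊗ (x·n)`, where `m·x` is the right action of `𝒜` on `M`. -/
def balancedRel : Submodule 𝒜 (M ⊗[ℂ] N) :=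
  Submodule.span 𝒜 {t | ∃ (m : M) (x : 𝒜) (n : N),
    t = (MulOpposite.op x • m) ⊗ₜ n - m ⊗ₜ (x • n)}

/-- The tensor product `M ⊗_𝒜 N` of an `𝒜`-bimodule `M` with a left `𝒜`-module `N`, over the
possibly noncommutative algebra `𝒜`. It is a left `𝒜`-module through `M`. -/
def BalancedTensor : Type _ := (M ⊗[ℂ] N) ⧸ balancedRel 𝒜 M N

instance : AddCommGroup (BalancedTensor 𝒜 M N) :=
  inferInstanceAs (AddCommGroup ((M ⊗[ℂ] N) ⧸ balancedRel 𝒜 M N))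

instance : Module 𝒜 (BalancedTensor 𝒜 M N) :=
  inferInstanceAs (Module 𝒜 ((M ⊗[ℂ] N) ⧸ balancedRel 𝒜 M N))

instance : Module ℂ (BalancedTensor 𝒜 M N) :=
  inferInstanceAs (Module ℂ ((M ⊗[ℂ] N) ⧸ balancedRel 𝒜 M N))

instance : IsScalarTower ℂ 𝒜 (BalancedTensor 𝒜 M N) :=
  inferInstanceAs (IsScalarTower ℂ 𝒜 ((M ⊗[ℂ] N) ⧸ balancedRel 𝒜 M N))

/-- The quotient map `M ⊗_ℂ N → M ⊗_𝒜 N`. -/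
def BalancedTensor.mkQ : M ⊗[ℂ] N →ₗ[𝒜] BalancedTensor 𝒜 M N := (balancedRel 𝒜 M N).mkQ

theorem BalancedTensor.mkQ_surjective : Function.Surjective (BalancedTensor.mkQ 𝒜 M N) :=
  Submodule.mkQ_surjective _

variable {M N} in
/-- The class of `m ⊗ n` in `M ⊗_𝒜 N`. -/
def btmul (m : M) (n : N) : BalancedTensor 𝒜 M N := BalancedTensor.mkQ 𝒜 M N (m ⊗ₜ n)

variable {M N} in
theorem btmul_balanced (m : M) (x : 𝒜) (n : N) :
    btmul 𝒜 (MulOpposite.op x • m) n = btmul 𝒜 m (x • n) :=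
  (Submodule.Quotient.eq _).2 (Submodule.subset_span ⟨m, x, n, rfl⟩)

variable {M N} in
theorem smul_btmul (x : 𝒜) (m : M) (n : N) : x • btmul 𝒜 m n = btmul 𝒜 (x • m) n := rfl

variable {M N} in
/-- A balanced map out of `M ⊗_ℂ N` descends to `M ⊗_𝒜 N`. -/
def BalancedTensor.lift {P : Type*} [AddCommGroup P] [Module 𝒜 P] (f : M ⊗[ℂ] N →ₗ[𝒜] P)
    (hf : ∀ (m : M) (x : 𝒜) (n : N), f ((MulOpposite.op x • m) ⊗ₜ n) = f (m ⊗ₜ (x • n))) :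
    BalancedTensor 𝒜 M N →ₗ[𝒜] P :=
  (balancedRel 𝒜 M N).liftQ f (by
    refine Submodule.span_le.2 ?_
    rintro _ ⟨m, x, n, rfl⟩
    rw [SetLike.mem_coe, LinearMap.mem_ker, map_sub, sub_eq_zero, hf])

variable {M N} in
theorem BalancedTensor.lift_btmul {P : Type*} [AddCommGroup P] [Module 𝒜 P]
    (f : M ⊗[ℂ] N →ₗ[𝒜] P)
    (hf : ∀ (m : M) (x : 𝒜) (n : N), f ((MulOpposite.op x • m) ⊗ₜ n) = f (m ⊗ₜ (x • n)))
    (m : M) (n : N) : BalancedTensor.lift 𝒜 f hf (btmul 𝒜 m n) = f (m ⊗ₜ n) := rfl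

variable {M N} in
/-- The left `𝒜`-linear map on `𝒜 ⊗ (V ⊗ W)` that sends `x ⊗ (v ⊗ w)` to `x · (f v ⊗ g w)`. -/
def extendPair {V W : Type*} [AddCommGroup V] [Module ℂ V] [AddCommGroup W] [Module ℂ W]
    (f : V →ₗ[ℂ] M) (g : W →ₗ[ℂ] N) : 𝒜 ⊗[ℂ] (V ⊗[ℂ] W) →ₗ[𝒜] BalancedTensor 𝒜 M N :=
  TensorProduct.AlgebraTensorModule.lift
    (LinearMap.toSpanSingleton 𝒜 (V ⊗[ℂ] W →ₗ[ℂ] BalancedTensor 𝒜 M N)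
      ((BalancedTensor.mkQ 𝒜 M N).restrictScalars ℂ ∘ₗ TensorProduct.map f g))

variable {M N} in
theorem extendPair_tmul {V W : Type*} [AddCommGroup V] [Module ℂ V] [AddCommGroup W] [Module ℂ W]
    (f : V →ₗ[ℂ] M) (g : W →ₗ[ℂ] N) (x : 𝒜) (v : V) (w : W) :
    extendPair 𝒜 f g (x ⊗ₜ (v ⊗ₜ w)) = x • btmul 𝒜 (f v) (g w) := rfl

end Balanced

section BaseChange

variable (𝒜) {V W : Type*} [AddCommGroup V] [Module ℂ V] [AddCommGroup W] [Module ℂ W]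

variable (V W) in
/-- The map `(x ⊗ v) ⊗ (y ⊗ w) ↦ (x y) ⊗ (v ⊗ w)`, before passing to `⊗_𝒜`. -/
def collectAux : (𝒜 ⊗[ℂ] V) ⊗[ℂ] (𝒜 ⊗[ℂ] W) →ₗ[𝒜] 𝒜 ⊗[ℂ] (V ⊗[ℂ] W) :=
  TensorProduct.AlgebraTensorModule.lift
    (TensorProduct.AlgebraTensorModule.lift
      (LinearMap.toSpanSingleton 𝒜 (V →ₗ[ℂ] 𝒜 ⊗[ℂ] W →ₗ[ℂ] 𝒜 ⊗[ℂ] (V ⊗[ℂ] W))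
        (LinearMap.lTensorHom 𝒜 ∘ₗ TensorProduct.mk ℂ V W)))

theorem collectAux_tmul (x y : 𝒜) (v : V) (w : W) :
    collectAux 𝒜 V W ((x ⊗ₜ v) ⊗ₜ (y ⊗ₜ w)) = (x * y) ⊗ₜ (v ⊗ₜ w) := rfl

variable (V W) in
/-- The canonical map `(𝒜 ⊗ V) ⊗_𝒜 (𝒜 ⊗ W) → 𝒜 ⊗ (V ⊗ W)`,
`(x ⊗ v) ⊗ (y ⊗ w) ↦ (x y) ⊗ (v ⊗ w)`. -/
def collect : BalancedTensor 𝒜 (𝒜 ⊗[ℂ] V) (𝒜 ⊗[ℂ] W) →ₗ[𝒜] 𝒜 ⊗[ℂ] (V ⊗[ℂ] W) :=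
  BalancedTensor.lift 𝒜 (collectAux 𝒜 V W) (by
    intro m x n
    induction m using TensorProduct.induction_on with
    | zero => rw [smul_zero, TensorProduct.zero_tmul, TensorProduct.zero_tmul]
    | add m m' hm hm' =>
      rw [smul_add, TensorProduct.add_tmul, TensorProduct.add_tmul, map_add, map_add, hm, hm']
    | tmul y v =>
      induction n using TensorProduct.induction_on with
      | zero => rw [smul_zero, TensorProduct.tmul_zero, TensorProduct.tmul_zero]
      | add n n' hn hn' =>
        rw [smul_add, TensorProduct.tmul_add, TensorProduct.tmul_add, map_add, map_add, hn, hn']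
      | tmul z w =>
        change collectAux 𝒜 V W (((y * x) ⊗ₜ v) ⊗ₜ (z ⊗ₜ w)) =
          collectAux 𝒜 V W ((y ⊗ₜ v) ⊗ₜ ((x * z) ⊗ₜ w))
        rw [collectAux_tmul, collectAux_tmul, mul_assoc])

theorem collect_btmul (x y : 𝒜) (v : V) (w : W) :
    collect 𝒜 V W (btmul 𝒜 (x ⊗ₜ v) (y ⊗ₜ w)) = (x * y) ⊗ₜ (v ⊗ₜ w) := rfl

variable (V W) in
/-- The inverse of the canonical map, `x ⊗ (v ⊗ w) ↦ (x ⊗ v) ⊗ (1 ⊗ w)`. -/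
def spread : 𝒜 ⊗[ℂ] (V ⊗[ℂ] W) →ₗ[𝒜] BalancedTensor 𝒜 (𝒜 ⊗[ℂ] V) (𝒜 ⊗[ℂ] W) :=
  extendPair 𝒜 (TensorProduct.mk ℂ 𝒜 V 1) (TensorProduct.mk ℂ 𝒜 W 1)

theorem spread_tmul (x : 𝒜) (v : V) (w : W) :
    spread 𝒜 V W (x ⊗ₜ (v ⊗ₜ w)) = btmul 𝒜 (x ⊗ₜ v) (1 ⊗ₜ w) := by
  change x • btmul 𝒜 ((1 : 𝒜) ⊗ₜ[ℂ] v) ((1 : 𝒜) ⊗ₜ[ℂ] w) = _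
  rw [smul_btmul, TensorProduct.smul_tmul', smul_eq_mul, mul_one]

theorem btmul_tmul_tmul (x y : 𝒜) (v : V) (w : W) :
    btmul 𝒜 ((x * y) ⊗ₜ[ℂ] v) ((1 : 𝒜) ⊗ₜ[ℂ] w) = btmul 𝒜 (x ⊗ₜ v) (y ⊗ₜ w) := by
  have h := btmul_balanced 𝒜 (x ⊗ₜ[ℂ] v) y ((1 : 𝒜) ⊗ₜ[ℂ] w)
  rw [TensorProduct.smul_tmul', TensorProduct.smul_tmul', smul_eq_mul, mul_one,
    MulOpposite.smul_eq_mul_unop, MulOpposite.unop_op] at h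
  exact h

theorem collect_spread (t : 𝒜 ⊗[ℂ] (V ⊗[ℂ] W)) : collect 𝒜 V W (spread 𝒜 V W t) = t := by
  induction t using TensorProduct.induction_on with
  | zero => rw [map_zero, map_zero]
  | add s t hs ht => rw [map_add, map_add, hs, ht]
  | tmul x u =>
    induction u using TensorProduct.induction_on with
    | zero => rw [TensorProduct.tmul_zero, map_zero, map_zero]
    | add u u' hu hu' => rw [TensorProduct.tmul_add, map_add, map_add, hu, hu']
    | tmul v w => rw [spread_tmul, collect_btmul, mul_one]

theorem spread_collect (t : BalancedTensor 𝒜 (𝒜 ⊗[ℂ] V) (𝒜 ⊗[ℂ] W)) :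
    spread 𝒜 V W (collect 𝒜 V W t) = t := by
  obtain ⟨t, rfl⟩ := BalancedTensor.mkQ_surjective 𝒜 (𝒜 ⊗[ℂ] V) (𝒜 ⊗[ℂ] W) t
  induction t using TensorProduct.induction_on with
  | zero => rw [map_zero, map_zero, map_zero]
  | add s t hs ht => rw [map_add, map_add, map_add, hs, ht]
  | tmul m n =>
    induction m using TensorProduct.induction_on with
    | zero => rw [TensorProduct.zero_tmul, map_zero, map_zero, map_zero]
    | add m m' hm hm' => rw [TensorProduct.add_tmul, map_add, map_add, map_add, hm, hm']
    | tmul x v =>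
      induction n using TensorProduct.induction_on with
      | zero => rw [TensorProduct.tmul_zero, map_zero, map_zero, map_zero]
      | add n n' hn hn' => rw [TensorProduct.tmul_add, map_add, map_add, map_add, hn, hn']
      | tmul y w =>
        change spread 𝒜 V W (collect 𝒜 V W (btmul 𝒜 (x ⊗ₜ v) (y ⊗ₜ w))) =
          btmul 𝒜 (x ⊗ₜ v) (y ⊗ₜ w)
        rw [collect_btmul, spread_tmul, btmul_tmul_tmul]

variable (V W) in
/-- The canonical identification `(𝒜 ⊗ V) ⊗_𝒜 (𝒜 ⊗ W) ≅ 𝒜 ⊗ (V ⊗ W)`. -/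
def collectEquiv : BalancedTensor 𝒜 (𝒜 ⊗[ℂ] V) (𝒜 ⊗[ℂ] W) ≃ₗ[𝒜] 𝒜 ⊗[ℂ] (V ⊗[ℂ] W) :=
  LinearEquiv.ofLinearMap (collect 𝒜 V W) (spread 𝒜 V W)
    (LinearMap.ext (collect_spread 𝒜)) (LinearMap.ext (spread_collect 𝒜))

variable {𝒜} in
/-- For `𝒜`-linear maps `f` and `g` the tensor product `f ⊗_𝒜 g` is the `𝒜`-linear map
determined by `(1 ⊗ v) ⊗ (1 ⊗ w) ↦ f (1 ⊗ v) ⊗ g (1 ⊗ w)`. As `f` need not be right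
`𝒜`-linear, this formula is imposed on the elements of `V` and `W` only. -/
def tensorMap (f : 𝒜 ⊗[ℂ] V →ₗ[𝒜] 𝒜 ⊗[ℂ] V) (g : 𝒜 ⊗[ℂ] W →ₗ[𝒜] 𝒜 ⊗[ℂ] W) :
    BalancedTensor 𝒜 (𝒜 ⊗[ℂ] V) (𝒜 ⊗[ℂ] W) →ₗ[𝒜]
      BalancedTensor 𝒜 (𝒜 ⊗[ℂ] V) (𝒜 ⊗[ℂ] W) :=
  extendPair 𝒜 (f.restrictScalars ℂ ∘ₗ TensorProduct.mk ℂ 𝒜 V 1)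
      (g.restrictScalars ℂ ∘ₗ TensorProduct.mk ℂ 𝒜 W 1) ∘ₗ
    (collectEquiv 𝒜 V W).toLinearMap

/-- The formula that determines `f ⊗_𝒜 g`. -/
theorem tensorMap_btmul (f : 𝒜 ⊗[ℂ] V →ₗ[𝒜] 𝒜 ⊗[ℂ] V) (g : 𝒜 ⊗[ℂ] W →ₗ[𝒜] 𝒜 ⊗[ℂ] W)
    (v : V) (w : W) :
    tensorMap f g (btmul 𝒜 ((1 : 𝒜) ⊗ₜ v) ((1 : 𝒜) ⊗ₜ w)) =
      btmul 𝒜 (f ((1 : 𝒜) ⊗ₜ v)) (g ((1 : 𝒜) ⊗ₜ w)) := by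
  change extendPair 𝒜 _ _ (collect 𝒜 V W (btmul 𝒜 ((1 : 𝒜) ⊗ₜ v) ((1 : 𝒜) ⊗ₜ w))) = _
  rw [collect_btmul, extendPair_tmul, one_mul, one_smul]
  rfl

/-- The `𝒜`-linear isomorphism
`Id_𝒜 ⊗ φ : (𝒜 ⊗ V) ⊗_𝒜 (𝒜 ⊗ W) → (𝒜 ⊗ V') ⊕ (𝒜 ⊗ W')` induced by a `ℂ`-linear isomorphism
`φ : V ⊗ W → V' ⊕ W'`. -/
def extendIso {V' W' : Type*} [AddCommGroup V'] [Module ℂ V'] [AddCommGroup W'] [Module ℂ W']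
    (φ : V ⊗[ℂ] W ≃ₗ[ℂ] V' × W') :
    BalancedTensor 𝒜 (𝒜 ⊗[ℂ] V) (𝒜 ⊗[ℂ] W) ≃ₗ[𝒜] (𝒜 ⊗[ℂ] V') × (𝒜 ⊗[ℂ] W') :=
  (collectEquiv 𝒜 V W).trans
    ((TensorProduct.AlgebraTensorModule.congr (LinearEquiv.refl 𝒜 𝒜) φ).trans
      (TensorProduct.prodRight ℂ 𝒜 𝒜 V' W'))

theorem extendIso_btmul {V' W' : Type*} [AddCommGroup V'] [Module ℂ V'] [AddCommGroup W']
    [Module ℂ W'] (φ : V ⊗[ℂ] W ≃ₗ[ℂ] V' × W') (x y : 𝒜) (v : V) (w : W) :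
    extendIso 𝒜 φ (btmul 𝒜 (x ⊗ₜ v) (y ⊗ₜ w)) =
      ((x * y) ⊗ₜ (φ (v ⊗ₜ w)).1, (x * y) ⊗ₜ (φ (v ⊗ₜ w)).2) := rfl

end BaseChange

end QuantumSL2
end

/-!
Write `V_k` for the homogeneous polynomials of degree `k` in the quantum plane and
`[k] = 1 + q² + ⋯ + q^(2(k-1))`. The isomorphism sends `Z ⊗ Q` in `V_1 ⊗ V_n` to the pair that
consists of the product `Z Q` in `V_(n+1)` and of the contraction
`∂_X Z ∂_Y Q - q⁻¹ ∂_Y Z ∂_X Q` in `V_(n-1)`, where `∂_X` and `∂_Y` are twisted partial derivatives.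
These satisfy the Leibniz rules

* `∂_X (X Q) = Q + q² X ∂_X Q` and `∂_Y (X Q) = q X ∂_Y Q`,
* `∂_X (Y Q) = q Y ∂_X Q` and `∂_Y (Y Q) = Q + q² Y ∂_Y Q + (q² - 1) X ∂_X Q`.

They exist because the rules define operators on triples `(Q, ∂_X Q, ∂_Y Q)` that satisfy the
relation of the quantum plane (`jetY_mul_jetX`); no basis of the quantum plane is needed.

Bijectivity: the Euler identity `X ∂_X Q + Y ∂_Y Q = [k] Q` on `V_k` (`euler`) and the relation
`∂_X ∂_Y = q ∂_Y ∂_X` (`derivX_derivY`) show that `[n+1]⁻¹ (P ↦ X ⊗ ∂_X P + Y ⊗ ∂_Y P)` on `V_(n+1)`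
and `[n+1]⁻¹ q² (R ↦ X ⊗ Y R - q⁻¹ Y ⊗ X R)` on `V_(n-1)` form a two-sided inverse
(`clebschGordan`). This is where `[n+1] ≠ 0` enters.

Equivariance: the product is equivariant because the substitution `A.subst` is an algebra
homomorphism. For the contraction, the chain rule `Point.extDeriv_subst` says that the substitution
transforms the gradient by the transpose of `A`; the relations of `SL₂^q`, in particular that the
quantum determinant is `1`, then give that the contraction is preserved (`Point.subst_contract`).
-/

noncomputable section

namespace QuantumSL2

variable {q : ℂˣ}

/-! ### The universal property of the quantum plane and induction on its elements -/

/-- The algebra homomorphism out of the quantum plane given by two elements `x`, `y` with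
`y x = q x y`. -/
def planeLift {B : Type*} [Ring B] [Algebra ℂ B] (x y : B) (h : y * x = (q : ℂ) • (x * y)) :
    Plane q →ₐ[ℂ] B :=
  RingQuot.liftAlgHom ℂ ⟨FreeAlgebra.lift ℂ ![x, y], by
    rintro _ _ ⟨⟩
    simpa using h⟩

theorem planeLift_X {B : Type*} [Ring B] [Algebra ℂ B] (x y : B)
    (h : y * x = (q : ℂ) • (x * y)) : planeLift x y h (planeX q) = x := by
  refine (RingQuot.liftAlgHom_mkAlgHom_apply ℂ (FreeAlgebra.lift ℂ ![x, y]) _ _).trans ?_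
  simp

theorem planeLift_Y {B : Type*} [Ring B] [Algebra ℂ B] (x y : B)
    (h : y * x = (q : ℂ) • (x * y)) : planeLift x y h (planeY q) = y := by
  refine (RingQuot.liftAlgHom_mkAlgHom_apply ℂ (FreeAlgebra.lift ℂ ![x, y]) _ _).trans ?_
  simp

/-- Induction principle: a subspace that contains `1` and is stable under left multiplication by
`X` and `Y` is the whole quantum plane. -/
theorem mem_of_mul_mem (S : Submodule ℂ (Plane q)) (h1 : 1 ∈ S)
    (hX : ∀ Q ∈ S, planeX q * Q ∈ S) (hY : ∀ Q ∈ S, planeY q * Q ∈ S) (P : Plane q) : P ∈ S := by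
  obtain ⟨f, rfl⟩ := RingQuot.mkAlgHom_surjective ℂ (PlaneRel q) P
  let π : FreeAlgebra ℂ (Fin 2) →ₐ[ℂ] Plane q := RingQuot.mkAlgHom ℂ (PlaneRel q)
  change π f ∈ S
  suffices h : ∀ Q ∈ S, π f * Q ∈ S by simpa using h 1 h1
  induction f using FreeAlgebra.induction with
  | grade0 r =>
    intro Q hQ
    rw [AlgHom.commutes, ← Algebra.smul_def]
    exact S.smul_mem r hQ
  | grade1 i =>
    fin_cases i
    · exact hX
    · exact hY
  | mul f g hf hg =>
    intro Q hQ
    rw [map_mul]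
    have := hf _ (hg Q hQ)
    rwa [← mul_assoc] at this
  | add f g hf hg =>
    intro Q hQ
    rw [map_add]
    have := S.add_mem (hf Q hQ) (hg Q hQ)
    rwa [← add_mul] at this

theorem planeY_mul_planeX_mul (P : Plane q) :
    planeY q * (planeX q * P) = (q : ℂ) • (planeX q * (planeY q * P)) := by
  rw [← mul_assoc, planeY_mul_planeX, smul_mul_assoc, mul_assoc]

/-! ### The quantum partial derivatives -/

/-- The action of `X` on triples `(Q, U, V)`, which stand for a polynomial and its two partial
derivatives: the Leibniz rule for multiplication by `X`. -/
def jetX (q : ℂˣ) : Module.End ℂ (Plane q × Plane q × Plane q) where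
  toFun t := (planeX q * t.1, t.1 + (q : ℂ) ^ 2 • (planeX q * t.2.1),
    (q : ℂ) • (planeX q * t.2.2))
  map_add' s t := by
    refine Prod.ext ?_ (Prod.ext ?_ ?_) <;>
      simp only [Prod.fst_add, Prod.snd_add, mul_add, smul_add] <;> abel
  map_smul' r t := by
    refine Prod.ext ?_ (Prod.ext ?_ ?_) <;>
      simp only [Prod.smul_fst, Prod.smul_snd, mul_smul_comm, smul_add, RingHom.id_apply] <;>
      simp only [smul_comm r]

/-- The action of `Y` on triples `(Q, U, V)`, which stand for a polynomial and its two partial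
derivatives: the Leibniz rule for multiplication by `Y`. -/
def jetY (q : ℂˣ) : Module.End ℂ (Plane q × Plane q × Plane q) where
  toFun t := (planeY q * t.1, (q : ℂ) • (planeY q * t.2.1),
    t.1 + (q : ℂ) ^ 2 • (planeY q * t.2.2) + ((q : ℂ) ^ 2 - 1) • (planeX q * t.2.1))
  map_add' s t := by
    refine Prod.ext ?_ (Prod.ext ?_ ?_) <;>
      simp only [Prod.fst_add, Prod.snd_add, mul_add, smul_add] <;> abel
  map_smul' r t := by
    refine Prod.ext ?_ (Prod.ext ?_ ?_) <;>
      simp only [Prod.smul_fst, Prod.smul_snd, mul_smul_comm, smul_add, RingHom.id_apply] <;>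
      simp only [smul_comm r]

/-- The Leibniz rules are compatible with the relation `Y X = q X Y`, so that the partial
derivatives exist on the quantum plane. -/
theorem jetY_mul_jetX (q : ℂˣ) : jetY q * jetX q = (q : ℂ) • (jetX q * jetY q) := by
  refine LinearMap.ext fun t ↦ Prod.ext ?_ (Prod.ext ?_ ?_)
  · exact planeY_mul_planeX_mul t.1
  · change (q : ℂ) • (planeY q * (t.1 + (q : ℂ) ^ 2 • (planeX q * t.2.1))) =
      (q : ℂ) • (planeY q * t.1 + (q : ℂ) ^ 2 • (planeX q * ((q : ℂ) • (planeY q * t.2.1))))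
    simp only [mul_add, mul_smul_comm, planeY_mul_planeX_mul]
  · change planeX q * t.1 + (q : ℂ) ^ 2 • (planeY q * ((q : ℂ) • (planeX q * t.2.2))) +
        ((q : ℂ) ^ 2 - 1) • (planeX q * (t.1 + (q : ℂ) ^ 2 • (planeX q * t.2.1))) =
      (q : ℂ) • (q : ℂ) • (planeX q * (t.1 + (q : ℂ) ^ 2 • (planeY q * t.2.2) +
        ((q : ℂ) ^ 2 - 1) • (planeX q * t.2.1)))
    simp only [mul_add, mul_smul_comm, planeY_mul_planeX_mul]
    module

/-- The action of the quantum plane on triples that extends `jetX` and `jetY`. -/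
def jet (q : ℂˣ) : Plane q →ₐ[ℂ] Module.End ℂ (Plane q × Plane q × Plane q) :=
  planeLift (jetX q) (jetY q) (jetY_mul_jetX q)

/-- The triple that consists of a polynomial and its two partial derivatives. -/
def jetOne (q : ℂˣ) : Plane q →ₗ[ℂ] Plane q × Plane q × Plane q :=
  LinearMap.applyₗ ((1, 0, 0) : Plane q × Plane q × Plane q) ∘ₗ (jet q).toLinearMap

theorem jetOne_X_mul (Q : Plane q) : jetOne q (planeX q * Q) = jetX q (jetOne q Q) := by
  change jet q (planeX q * Q) _ = _
  rw [map_mul, jet, planeLift_X]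
  rfl

theorem jetOne_Y_mul (Q : Plane q) : jetOne q (planeY q * Q) = jetY q (jetOne q Q) := by
  change jet q (planeY q * Q) _ = _
  rw [map_mul, jet, planeLift_Y]
  rfl

theorem jetOne_one : jetOne q 1 = (1, 0, 0) := by
  change jet q 1 _ = _
  rw [map_one]
  rfl

theorem jetOne_fst (Q : Plane q) : (jetOne q Q).1 = Q := by
  refine mem_of_mul_mem
    (LinearMap.eqLocus (LinearMap.fst ℂ _ _ ∘ₗ jetOne q) LinearMap.id) ?_ ?_ ?_ Q
  · exact congrArg Prod.fst jetOne_one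
  · intro Q hQ
    exact (congrArg Prod.fst (jetOne_X_mul Q)).trans (congrArg (planeX q * ·) hQ)
  · intro Q hQ
    exact (congrArg Prod.fst (jetOne_Y_mul Q)).trans (congrArg (planeY q * ·) hQ)

/-- The quantum partial derivative with respect to `X`: `X^i Y^j ↦ [i] X^(i-1) Y^j`, where
`[i] = 1 + q² + ⋯ + q^(2(i-1))`. -/
def derivX (q : ℂˣ) : Plane q →ₗ[ℂ] Plane q :=
  LinearMap.fst ℂ _ _ ∘ₗ LinearMap.snd ℂ _ _ ∘ₗ jetOne q

/-- The quantum partial derivative with respect to `Y`: `X^i Y^j ↦ q^i [j] X^i Y^(j-1)`, where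
`[j] = 1 + q² + ⋯ + q^(2(j-1))`. -/
def derivY (q : ℂˣ) : Plane q →ₗ[ℂ] Plane q :=
  LinearMap.snd ℂ _ _ ∘ₗ LinearMap.snd ℂ _ _ ∘ₗ jetOne q

theorem derivX_one : derivX q 1 = 0 :=
  congrArg (fun t : Plane q × Plane q × Plane q ↦ t.2.1) jetOne_one

theorem derivY_one : derivY q 1 = 0 :=
  congrArg (fun t : Plane q × Plane q × Plane q ↦ t.2.2) jetOne_one

theorem derivX_X_mul (Q : Plane q) :
    derivX q (planeX q * Q) = Q + (q : ℂ) ^ 2 • (planeX q * derivX q Q) := by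
  refine (congrArg (fun t ↦ t.2.1) (jetOne_X_mul Q)).trans ?_
  change (jetOne q Q).1 + _ = _
  rw [jetOne_fst]
  rfl

theorem derivY_X_mul (Q : Plane q) :
    derivY q (planeX q * Q) = (q : ℂ) • (planeX q * derivY q Q) :=
  congrArg (fun t ↦ t.2.2) (jetOne_X_mul Q)

theorem derivX_Y_mul (Q : Plane q) :
    derivX q (planeY q * Q) = (q : ℂ) • (planeY q * derivX q Q) :=
  congrArg (fun t ↦ t.2.1) (jetOne_Y_mul Q)

theorem derivY_Y_mul (Q : Plane q) :
    derivY q (planeY q * Q) = Q + (q : ℂ) ^ 2 • (planeY q * derivY q Q) +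
      ((q : ℂ) ^ 2 - 1) • (planeX q * derivX q Q) := by
  refine (congrArg (fun t ↦ t.2.2) (jetOne_Y_mul Q)).trans ?_
  change (jetOne q Q).1 + _ + _ = _
  rw [jetOne_fst]
  rfl

theorem derivX_X : derivX q (planeX q) = 1 := by
  simpa [derivX_one] using derivX_X_mul (1 : Plane q)

theorem derivY_X : derivY q (planeX q) = 0 := by
  simpa [derivY_one] using derivY_X_mul (1 : Plane q)

theorem derivX_Y : derivX q (planeY q) = 0 := by
  simpa [derivX_one] using derivX_Y_mul (1 : Plane q)

theorem derivY_Y : derivY q (planeY q) = 1 := by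
  simpa [derivX_one, derivY_one] using derivY_Y_mul (1 : Plane q)

/-- The quantum integer `[n] = 1 + q² + ⋯ + q^(2(n-1))`. -/
def qInt (q : ℂˣ) (n : ℕ) : ℂ := ∑ j ∈ Finset.range n, (q : ℂ) ^ (2 * j)

theorem qInt_zero : qInt q 0 = 0 := rfl

theorem qInt_succ (n : ℕ) : qInt q (n + 1) = 1 + (q : ℂ) ^ 2 * qInt q n := by
  rw [qInt, qInt, Finset.sum_range_succ', Finset.mul_sum, add_comm]
  congr 1
  exact Finset.sum_congr rfl fun j _ ↦ by ring

/-! ### Homogeneous parts -/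

theorem planeX_mul_mem {n : ℕ} {P : Plane q} (hP : P ∈ planeHom q n) :
    planeX q * P ∈ planeHom q (n + 1) := by
  induction hP using Submodule.span_induction with
  | mem P h =>
    obtain ⟨i, j, rfl, rfl⟩ := h
    rw [← mul_assoc, ← pow_succ']
    exact Submodule.subset_span ⟨i + 1, j, by omega, rfl⟩
  | zero => simp
  | add P Q _ _ hP hQ => rw [mul_add]; exact Submodule.add_mem _ hP hQ
  | smul r P _ hP => rw [mul_smul_comm]; exact Submodule.smul_mem _ _ hP

theorem planeY_mul_planeX_pow (i : ℕ) :
    planeY q * planeX q ^ i = (q : ℂ) ^ i • (planeX q ^ i * planeY q) := by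
  induction i with
  | zero => simp
  | succ i ih =>
    rw [pow_succ, ← mul_assoc, ih, smul_mul_assoc, mul_assoc, planeY_mul_planeX, mul_smul_comm,
      smul_smul, ← mul_assoc, pow_succ]

theorem planeY_mul_mem {n : ℕ} {P : Plane q} (hP : P ∈ planeHom q n) :
    planeY q * P ∈ planeHom q (n + 1) := by
  induction hP using Submodule.span_induction with
  | mem P h =>
    obtain ⟨i, j, rfl, rfl⟩ := h
    rw [← mul_assoc, planeY_mul_planeX_pow, smul_mul_assoc, mul_assoc, ← pow_succ']
    exact Submodule.smul_mem _ _ (Submodule.subset_span ⟨i, j + 1, by omega, rfl⟩)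
  | zero => simp
  | add P Q _ _ hP hQ => rw [mul_add]; exact Submodule.add_mem _ hP hQ
  | smul r P _ hP => rw [mul_smul_comm]; exact Submodule.smul_mem _ _ hP

theorem eq_smul_one_of_mem_planeHom_zero {P : Plane q} (hP : P ∈ planeHom q 0) :
    ∃ c : ℂ, P = c • 1 := by
  induction hP using Submodule.span_induction with
  | mem P h =>
    obtain ⟨i, j, h, rfl⟩ := h
    obtain ⟨rfl, rfl⟩ : i = 0 ∧ j = 0 := by omega
    exact ⟨1, by simp⟩
  | zero => exact ⟨0, by simp⟩
  | add P Q _ _ hP hQ =>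
    obtain ⟨⟨c, rfl⟩, d, rfl⟩ := And.intro hP hQ
    exact ⟨c + d, by rw [add_smul]⟩
  | smul r P _ hP =>
    obtain ⟨c, rfl⟩ := hP
    exact ⟨r * c, by rw [mul_smul]⟩

/-- Every homogeneous polynomial of positive degree has the form `X P + Y Q`. -/
theorem planeHom_succ_induction {n : ℕ} {p : Plane q → Prop}
    (hX : ∀ P ∈ planeHom q n, p (planeX q * P)) (hY : ∀ P ∈ planeHom q n, p (planeY q * P))
    (hadd : ∀ P Q, p P → p Q → p (P + Q)) {P : Plane q} (hP : P ∈ planeHom q (n + 1)) : p P := by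
  have hz : p 0 := by simpa using hX 0 (Submodule.zero_mem _)
  suffices h : ∃ Q ∈ planeHom q n, ∃ R ∈ planeHom q n, P = planeX q * Q + planeY q * R by
    obtain ⟨Q, hQ, R, hR, rfl⟩ := h
    exact hadd _ _ (hX Q hQ) (hY R hR)
  clear hX hY hadd hz
  induction hP using Submodule.span_induction with
  | mem P h =>
    obtain ⟨i, j, h, rfl⟩ := h
    rcases i with _ | i
    · obtain rfl : j = n + 1 := by omega
      refine ⟨0, Submodule.zero_mem _, planeY q ^ n, Submodule.subset_span ⟨0, n, ?_, ?_⟩, ?_⟩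
      · omega
      · simp
      · simp [pow_succ']
    · refine ⟨planeX q ^ i * planeY q ^ j, Submodule.subset_span ⟨i, j, by omega, rfl⟩, 0,
        Submodule.zero_mem _, ?_⟩
      rw [mul_zero, add_zero, ← mul_assoc, ← pow_succ']
  | zero => exact ⟨0, Submodule.zero_mem _, 0, Submodule.zero_mem _, by simp⟩
  | add P Q _ _ hP hQ =>
    obtain ⟨P, hP, R, hR, rfl⟩ := hP
    obtain ⟨Q, hQ, S, hS, rfl⟩ := hQ
    exact ⟨P + Q, Submodule.add_mem _ hP hQ, R + S, Submodule.add_mem _ hR hS,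
      by rw [mul_add, mul_add]; abel⟩
  | smul r P _ hP =>
    obtain ⟨P, hP, R, hR, rfl⟩ := hP
    exact ⟨r • P, Submodule.smul_mem _ r hP, r • R, Submodule.smul_mem _ r hR,
      by rw [smul_add, mul_smul_comm, mul_smul_comm]⟩

theorem deriv_of_mem_zero {P : Plane q} (hP : P ∈ planeHom q 0) :
    derivX q P = 0 ∧ derivY q P = 0 := by
  obtain ⟨c, rfl⟩ := eq_smul_one_of_mem_planeHom_zero hP
  simp [derivX_one, derivY_one]

theorem deriv_mem {n : ℕ} {P : Plane q} (hP : P ∈ planeHom q (n + 1)) :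
    derivX q P ∈ planeHom q n ∧ derivY q P ∈ planeHom q n := by
  induction n generalizing P with
  | zero =>
    refine planeHom_succ_induction
      (p := fun P ↦ derivX q P ∈ planeHom q 0 ∧ derivY q P ∈ planeHom q 0)
      (fun P hP ↦ ?_) (fun P hP ↦ ?_) (fun P Q hP hQ ↦ ?_) hP
    · simp only [derivX_X_mul, derivY_X_mul, (deriv_of_mem_zero hP).1, (deriv_of_mem_zero hP).2]
      simp [hP]
    · simp only [derivX_Y_mul, derivY_Y_mul, (deriv_of_mem_zero hP).1, (deriv_of_mem_zero hP).2]
      simp [hP]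
    · simp only [map_add]
      exact ⟨Submodule.add_mem _ hP.1 hQ.1, Submodule.add_mem _ hP.2 hQ.2⟩
  | succ n ih =>
    refine planeHom_succ_induction
      (p := fun P ↦ derivX q P ∈ planeHom q (n + 1) ∧ derivY q P ∈ planeHom q (n + 1))
      (fun P hP ↦ ?_) (fun P hP ↦ ?_) (fun P Q hP hQ ↦ ?_) hP
    · rw [derivX_X_mul, derivY_X_mul]
      exact ⟨Submodule.add_mem _ hP (Submodule.smul_mem _ _ (planeX_mul_mem (ih hP).1)),
        Submodule.smul_mem _ _ (planeX_mul_mem (ih hP).2)⟩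
    · rw [derivX_Y_mul, derivY_Y_mul]
      exact ⟨Submodule.smul_mem _ _ (planeY_mul_mem (ih hP).1),
        Submodule.add_mem _ (Submodule.add_mem _ hP
          (Submodule.smul_mem _ _ (planeY_mul_mem (ih hP).2)))
          (Submodule.smul_mem _ _ (planeX_mul_mem (ih hP).1))⟩
    · simp only [map_add]
      exact ⟨Submodule.add_mem _ hP.1 hQ.1, Submodule.add_mem _ hP.2 hQ.2⟩

/-- The quantum Euler identity for homogeneous polynomials. -/
theorem euler {n : ℕ} {P : Plane q} (hP : P ∈ planeHom q n) :
    planeX q * derivX q P + planeY q * derivY q P = qInt q n • P := by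
  induction n generalizing P with
  | zero => simp [deriv_of_mem_zero hP, qInt_zero]
  | succ n ih =>
    refine planeHom_succ_induction
      (p := fun P ↦ planeX q * derivX q P + planeY q * derivY q P = qInt q (n + 1) • P)
      (fun P hP ↦ ?_) (fun P hP ↦ ?_) (fun P Q hP hQ ↦ ?_) hP
    · rw [derivX_X_mul, derivY_X_mul, qInt_succ, add_smul, mul_smul, ← mul_smul_comm (qInt q n),
        ← ih hP]
      simp only [mul_add, mul_smul_comm, planeY_mul_planeX_mul]
      module
    · rw [derivX_Y_mul, derivY_Y_mul, qInt_succ, add_smul, mul_smul, ← mul_smul_comm (qInt q n),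
        ← ih hP]
      simp only [mul_add, mul_smul_comm, planeY_mul_planeX_mul]
      module
    · rw [map_add, map_add, smul_add, ← hP, ← hQ, mul_add, mul_add]
      abel

theorem derivX_derivY (P : Plane q) : derivX q (derivY q P) = (q : ℂ) • derivY q (derivX q P) := by
  refine mem_of_mul_mem (LinearMap.eqLocus (derivX q ∘ₗ derivY q)
    ((q : ℂ) • (derivY q ∘ₗ derivX q))) ?_ (fun P hP ↦ ?_) (fun P hP ↦ ?_) P
  · change derivX q (derivY q 1) = (q : ℂ) • derivY q (derivX q 1)
    simp [derivX_one, derivY_one]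
  · have h : derivX q (derivY q P) = (q : ℂ) • derivY q (derivX q P) := hP
    change derivX q (derivY q (planeX q * P)) = (q : ℂ) • derivY q (derivX q (planeX q * P))
    simp only [derivX_X_mul, derivY_X_mul, map_add, map_smul, h, mul_smul_comm]
  · have h : derivX q (derivY q P) = (q : ℂ) • derivY q (derivX q P) := hP
    change derivX q (derivY q (planeY q * P)) = (q : ℂ) • derivY q (derivX q (planeY q * P))
    simp only [derivX_X_mul, derivX_Y_mul, derivY_Y_mul, map_add, map_smul, h, mul_smul_comm]
    module

variable {𝒜 : Type*} [Ring 𝒜] [Algebra ℂ 𝒜]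

/-! ### Equivariance of the quantum partial derivatives -/

variable (q) in
/-- An element of `𝒜` as a constant of the quantum `𝒜`-plane. -/
def const : 𝒜 →ₐ[ℂ] 𝒜 ⊗[ℂ] Plane q := Algebra.TensorProduct.includeLeft

variable (q 𝒜) in
/-- The variable `X` of the quantum `𝒜`-plane. -/
def varX : 𝒜 ⊗[ℂ] Plane q := 1 ⊗ₜ planeX q

variable (q 𝒜) in
/-- The variable `Y` of the quantum `𝒜`-plane. -/
def varY : 𝒜 ⊗[ℂ] Plane q := 1 ⊗ₜ planeY q

variable (q 𝒜) in
/-- The extension of `derivX` to the quantum `𝒜`-plane, which does not differentiate the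
coefficients. -/
def extDerivX : 𝒜 ⊗[ℂ] Plane q →ₗ[ℂ] 𝒜 ⊗[ℂ] Plane q := (derivX q).lTensor 𝒜

variable (q 𝒜) in
/-- The extension of `derivY` to the quantum `𝒜`-plane, which does not differentiate the
coefficients. -/
def extDerivY : 𝒜 ⊗[ℂ] Plane q →ₗ[ℂ] 𝒜 ⊗[ℂ] Plane q := (derivY q).lTensor 𝒜

theorem extDerivX_tmul (x : 𝒜) (P : Plane q) :
    extDerivX q 𝒜 (x ⊗ₜ P) = x ⊗ₜ derivX q P := rfl

theorem extDerivY_tmul (x : 𝒜) (P : Plane q) :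
    extDerivY q 𝒜 (x ⊗ₜ P) = x ⊗ₜ derivY q P := rfl

theorem const_mul_tmul (x y : 𝒜) (P : Plane q) : const q x * (y ⊗ₜ P) = (x * y) ⊗ₜ P := by
  simp [const]

theorem varX_mul_tmul (y : 𝒜) (P : Plane q) : varX q 𝒜 * (y ⊗ₜ P) = y ⊗ₜ (planeX q * P) := by
  simp [varX]

theorem varY_mul_tmul (y : 𝒜) (P : Plane q) : varY q 𝒜 * (y ⊗ₜ P) = y ⊗ₜ (planeY q * P) := by
  simp [varY]

theorem extDerivX_const_mul (x : 𝒜) (F : 𝒜 ⊗[ℂ] Plane q) :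
    extDerivX q 𝒜 (const q x * F) = const q x * extDerivX q 𝒜 F := by
  induction F using TensorProduct.induction_on with
  | zero => simp
  | add F G hF hG => simp only [mul_add, map_add, hF, hG]
  | tmul y P => simp only [const_mul_tmul, extDerivX_tmul]

theorem extDerivY_const_mul (x : 𝒜) (F : 𝒜 ⊗[ℂ] Plane q) :
    extDerivY q 𝒜 (const q x * F) = const q x * extDerivY q 𝒜 F := by
  induction F using TensorProduct.induction_on with
  | zero => simp
  | add F G hF hG => simp only [mul_add, map_add, hF, hG]
  | tmul y P => simp only [const_mul_tmul, extDerivY_tmul]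

theorem varX_mul_const_mul (x : 𝒜) (F : 𝒜 ⊗[ℂ] Plane q) :
    varX q 𝒜 * (const q x * F) = const q x * (varX q 𝒜 * F) := by
  simp [varX, const, ← mul_assoc]

theorem varY_mul_const_mul (x : 𝒜) (F : 𝒜 ⊗[ℂ] Plane q) :
    varY q 𝒜 * (const q x * F) = const q x * (varY q 𝒜 * F) := by
  simp [varY, const, ← mul_assoc]

theorem extDerivX_varX_mul (F : 𝒜 ⊗[ℂ] Plane q) :
    extDerivX q 𝒜 (varX q 𝒜 * F) = F + (q : ℂ) ^ 2 • (varX q 𝒜 * extDerivX q 𝒜 F) := by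
  induction F using TensorProduct.induction_on with
  | zero => simp
  | add F G hF hG => simp only [mul_add, map_add, hF, hG]; module
  | tmul y P =>
    simp only [varX_mul_tmul, extDerivX_tmul, derivX_X_mul, TensorProduct.tmul_add,
      TensorProduct.tmul_smul]

theorem extDerivY_varX_mul (F : 𝒜 ⊗[ℂ] Plane q) :
    extDerivY q 𝒜 (varX q 𝒜 * F) = (q : ℂ) • (varX q 𝒜 * extDerivY q 𝒜 F) := by
  induction F using TensorProduct.induction_on with
  | zero => simp
  | add F G hF hG => simp only [mul_add, map_add, hF, hG, smul_add]
  | tmul y P =>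
    simp only [varX_mul_tmul, extDerivY_tmul, derivY_X_mul, TensorProduct.tmul_smul]

theorem extDerivX_varY_mul (F : 𝒜 ⊗[ℂ] Plane q) :
    extDerivX q 𝒜 (varY q 𝒜 * F) = (q : ℂ) • (varY q 𝒜 * extDerivX q 𝒜 F) := by
  induction F using TensorProduct.induction_on with
  | zero => simp
  | add F G hF hG => simp only [mul_add, map_add, hF, hG, smul_add]
  | tmul y P =>
    simp only [varY_mul_tmul, extDerivX_tmul, derivX_Y_mul, TensorProduct.tmul_smul]

theorem extDerivY_varY_mul (F : 𝒜 ⊗[ℂ] Plane q) :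
    extDerivY q 𝒜 (varY q 𝒜 * F) = F + (q : ℂ) ^ 2 • (varY q 𝒜 * extDerivY q 𝒜 F) +
      ((q : ℂ) ^ 2 - 1) • (varX q 𝒜 * extDerivX q 𝒜 F) := by
  induction F using TensorProduct.induction_on with
  | zero => simp
  | add F G hF hG => simp only [mul_add, map_add, hF, hG]; module
  | tmul y P =>
    simp only [varX_mul_tmul, varY_mul_tmul, extDerivX_tmul, extDerivY_tmul, derivY_Y_mul,
      TensorProduct.tmul_add, TensorProduct.tmul_smul]

namespace Point

variable (A : Point q 𝒜)

theorem imX_mul (F : 𝒜 ⊗[ℂ] Plane q) :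
    A.imX * F = const q A.a * (varX q 𝒜 * F) + const q A.b * (varY q 𝒜 * F) := by
  simp [imX, const, varX, varY, ← mul_assoc, add_mul]

theorem imY_mul (F : 𝒜 ⊗[ℂ] Plane q) :
    A.imY * F = const q A.c * (varX q 𝒜 * F) + const q A.d * (varY q 𝒜 * F) := by
  simp [imY, const, varX, varY, ← mul_assoc, add_mul]

/-! The relations of `SL₂^q` as rewriting rules. Together they bring a product of two entries of
`A` into the order `a`, `c`, `b`, `d`, and they eliminate `a d` and `d a`. -/

theorem const_b_mul_a (F : 𝒜 ⊗[ℂ] Plane q) :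
    const q A.b * (const q A.a * F) = (q : ℂ) • (const q A.a * (const q A.b * F)) := by
  rw [← mul_assoc, ← map_mul, A.ba, map_smul, map_mul, smul_mul_assoc, mul_assoc]

theorem const_d_mul_b (F : 𝒜 ⊗[ℂ] Plane q) :
    const q A.d * (const q A.b * F) = (q : ℂ) • (const q A.b * (const q A.d * F)) := by
  rw [← mul_assoc, ← map_mul, A.db, map_smul, map_mul, smul_mul_assoc, mul_assoc]

theorem const_b_mul_c (F : 𝒜 ⊗[ℂ] Plane q) :
    const q A.b * (const q A.c * F) = const q A.c * (const q A.b * F) := by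
  rw [← mul_assoc, ← map_mul, A.bc, map_mul, mul_assoc]

theorem const_c_mul_a (F : 𝒜 ⊗[ℂ] Plane q) :
    const q A.c * (const q A.a * F) = (q : ℂ) • (const q A.a * (const q A.c * F)) := by
  rw [← mul_assoc, ← map_mul, A.ca, map_smul, map_mul, smul_mul_assoc, mul_assoc]

theorem const_d_mul_c (F : 𝒜 ⊗[ℂ] Plane q) :
    const q A.d * (const q A.c * F) = (q : ℂ) • (const q A.c * (const q A.d * F)) := by
  rw [← mul_assoc, ← map_mul, A.dc, map_smul, map_mul, smul_mul_assoc, mul_assoc]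

theorem const_a_mul_d (F : 𝒜 ⊗[ℂ] Plane q) :
    const q A.a * (const q A.d * F) = F + (q : ℂ)⁻¹ • (const q A.c * (const q A.b * F)) := by
  rw [← mul_assoc, ← map_mul, sub_eq_iff_eq_add.1 A.det, A.bc, map_add, map_one, map_smul,
    map_mul, add_mul, one_mul, smul_mul_assoc, mul_assoc]

theorem const_d_mul_a (F : 𝒜 ⊗[ℂ] Plane q) :
    const q A.d * (const q A.a * F) = F + (q : ℂ) • (const q A.c * (const q A.b * F)) := by
  rw [← mul_assoc, ← map_mul, sub_eq_iff_eq_add.1 (A.ad_da.symm.trans A.det), A.bc, map_add,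
    map_one, map_smul, map_mul, add_mul, one_mul, smul_mul_assoc, mul_assoc]

/-- The pair of partial derivatives of `P(aX + bY, cX + dY)` is the transpose of the matrix `A`
applied to the pair of partial derivatives of `P`: the chain rule for the quantum plane. -/
theorem extDeriv_subst (P : Plane q) :
    extDerivX q 𝒜 (A.subst P) =
        const q A.a * A.subst (derivX q P) + const q A.c * A.subst (derivY q P) ∧
      extDerivY q 𝒜 (A.subst P) =
        const q A.b * A.subst (derivX q P) + const q A.d * A.subst (derivY q P) := by
  let S : Submodule ℂ (Plane q) :=
    LinearMap.eqLocus (extDerivX q 𝒜 ∘ₗ A.subst.toLinearMap)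
        (LinearMap.mulLeft ℂ (const q A.a) ∘ₗ A.subst.toLinearMap ∘ₗ derivX q +
          LinearMap.mulLeft ℂ (const q A.c) ∘ₗ A.subst.toLinearMap ∘ₗ derivY q) ⊓
      LinearMap.eqLocus (extDerivY q 𝒜 ∘ₗ A.subst.toLinearMap)
        (LinearMap.mulLeft ℂ (const q A.b) ∘ₗ A.subst.toLinearMap ∘ₗ derivX q +
          LinearMap.mulLeft ℂ (const q A.d) ∘ₗ A.subst.toLinearMap ∘ₗ derivY q)
  have mem_S (P : Plane q) : P ∈ S ↔ (extDerivX q 𝒜 (A.subst P) =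
        const q A.a * A.subst (derivX q P) + const q A.c * A.subst (derivY q P) ∧
      extDerivY q 𝒜 (A.subst P) =
        const q A.b * A.subst (derivX q P) + const q A.d * A.subst (derivY q P)) := Iff.rfl
  have hq := q.ne_zero
  rw [← mem_S]
  -- The relations of `SL₂^q` bring both sides of the chain rule for `X P` and `Y P` into a normal
  -- form, in which only the scalar coefficients remain to be compared.
  refine mem_of_mul_mem S ?_ (fun P hP ↦ ?_) (fun P hP ↦ ?_) P
  · rw [mem_S]
    simp [derivX_one, derivY_one, Algebra.TensorProduct.one_def, extDerivX_tmul, extDerivY_tmul]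
  · rw [mem_S] at hP ⊢
    constructor <;>
    · simp only [map_mul, map_add, map_smul, A.subst_X, A.imX_mul, derivX_X_mul, derivY_X_mul,
        extDerivX_const_mul, extDerivY_const_mul, extDerivX_varX_mul, extDerivX_varY_mul,
        extDerivY_varX_mul, extDerivY_varY_mul, hP.1, hP.2, mul_add, mul_smul_comm,
        varX_mul_const_mul, varY_mul_const_mul, A.const_b_mul_a, A.const_d_mul_b,
        A.const_b_mul_c, A.const_c_mul_a, A.const_a_mul_d, A.const_d_mul_a]
      match_scalars <;> field_simp <;> ring
  · rw [mem_S] at hP ⊢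
    constructor <;>
    · simp only [map_mul, map_add, map_smul, A.subst_Y, A.imY_mul, derivX_Y_mul, derivY_Y_mul,
        A.subst_X, A.imX_mul,
        extDerivX_const_mul, extDerivY_const_mul, extDerivX_varX_mul, extDerivX_varY_mul,
        extDerivY_varX_mul, extDerivY_varY_mul, hP.1, hP.2, mul_add, mul_smul_comm,
        varX_mul_const_mul, varY_mul_const_mul, A.const_d_mul_b,
        A.const_b_mul_c, A.const_c_mul_a, A.const_d_mul_c, A.const_a_mul_d, A.const_d_mul_a]
      match_scalars <;> field_simp <;> ring

end Point

/-! ### The contraction of a linear form with a gradient -/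

theorem eq_of_mem_planeHom_one {P : Plane q} (hP : P ∈ planeHom q 1) :
    ∃ α β : ℂ, P = α • planeX q + β • planeY q := by
  refine planeHom_succ_induction (n := 0) (p := fun P ↦ ∃ α β : ℂ, P = α • planeX q + β • planeY q)
    (fun P hP ↦ ?_) (fun P hP ↦ ?_) (fun P Q hP hQ ↦ ?_) hP
  · obtain ⟨c, rfl⟩ := eq_smul_one_of_mem_planeHom_zero hP
    exact ⟨c, 0, by simp⟩
  · obtain ⟨c, rfl⟩ := eq_smul_one_of_mem_planeHom_zero hP
    exact ⟨0, c, by simp⟩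
  · obtain ⟨⟨α, β, rfl⟩, γ, δ, rfl⟩ := And.intro hP hQ
    exact ⟨α + γ, β + δ, by module⟩

variable (q) in
/-- The bilinear map `(Z, Q) ↦ ∂_X Z ∂_Y Q - q⁻¹ ∂_Y Z ∂_X Q`. For a linear form `Z` it contracts
`Z` with the gradient of `Q`, by means of the invariant bilinear form `⟨X, Y⟩ = 1`,
`⟨Y, X⟩ = -q⁻¹`, `⟨X, X⟩ = ⟨Y, Y⟩ = 0` on linear forms. -/
def contract : Plane q →ₗ[ℂ] Plane q →ₗ[ℂ] Plane q :=
  (LinearMap.mul ℂ (Plane q)).compl₁₂ (derivX q) (derivY q) -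
    (q : ℂ)⁻¹ • (LinearMap.mul ℂ (Plane q)).compl₁₂ (derivY q) (derivX q)

theorem contract_apply (P Q : Plane q) : contract q P Q =
    derivX q P * derivY q Q - (q : ℂ)⁻¹ • (derivY q P * derivX q Q) := rfl

theorem contract_linear (α β : ℂ) (Q : Plane q) :
    contract q (α • planeX q + β • planeY q) Q =
      α • derivY q Q - (q : ℂ)⁻¹ • β • derivX q Q := by
  rw [contract_apply]
  simp only [map_add, map_smul, derivX_X, derivX_Y, derivY_X, derivY_Y, smul_zero,
    add_zero, zero_add, smul_mul_assoc, one_mul]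

theorem contract_mem {n : ℕ} {P Q : Plane q} (hP : P ∈ planeHom q 1)
    (hQ : Q ∈ planeHom q (n + 1)) : contract q P Q ∈ planeHom q n := by
  obtain ⟨α, β, rfl⟩ := eq_of_mem_planeHom_one hP
  rw [contract_linear]
  exact Submodule.sub_mem _ (Submodule.smul_mem _ _ (deriv_mem hQ).2)
    (Submodule.smul_mem _ _ (Submodule.smul_mem _ _ (deriv_mem hQ).1))

/-- Contraction commutes with the action of `A`. -/
theorem Point.subst_contract (A : Point q 𝒜) {P : Plane q} (hP : P ∈ planeHom q 1)
    (Q : Plane q) :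
    extDerivX q 𝒜 (A.subst P) * extDerivY q 𝒜 (A.subst Q) -
        (q : ℂ)⁻¹ • (extDerivY q 𝒜 (A.subst P) * extDerivX q 𝒜 (A.subst Q)) =
      A.subst (contract q P Q) := by
  have hq := q.ne_zero
  obtain ⟨α, β, rfl⟩ := eq_of_mem_planeHom_one hP
  rw [contract_linear, (A.extDeriv_subst _).1, (A.extDeriv_subst _).2, (A.extDeriv_subst _).1,
    (A.extDeriv_subst _).2]
  simp only [map_add, map_sub, map_smul, derivX_X, derivX_Y, derivY_X, derivY_Y, smul_zero,
    add_zero, zero_add, map_one, mul_smul_comm, mul_one, smul_mul_assoc, add_mul, mul_add,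
    A.const_b_mul_a, A.const_b_mul_c, A.const_d_mul_c, A.const_a_mul_d, A.const_d_mul_a]
  match_scalars <;> field_simp <;> ring

/-! ### The decomposition -/

/-- The map between homogeneous parts induced by a linear map on the quantum plane. -/
def homRestrict (f : Plane q →ₗ[ℂ] Plane q) {n k : ℕ}
    (h : ∀ P ∈ planeHom q n, f P ∈ planeHom q k) : PlaneHom q n →ₗ[ℂ] PlaneHom q k :=
  LinearMap.restrict f h

/-- The map from a tensor product of homogeneous parts induced by a bilinear map on the quantum
plane. -/
def homLift (B : Plane q →ₗ[ℂ] Plane q →ₗ[ℂ] Plane q) {m n k : ℕ}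
    (h : ∀ P ∈ planeHom q m, ∀ Q ∈ planeHom q n, B P Q ∈ planeHom q k) :
    PlaneHom q m ⊗[ℂ] PlaneHom q n →ₗ[ℂ] PlaneHom q k :=
  LinearMap.codRestrict (planeHom q k)
    (TensorProduct.lift (B.compl₁₂ (planeIncl q m) (planeIncl q n))) fun t ↦ by
      induction t using TensorProduct.induction_on with
      | zero => simp
      | add s t hs ht => rw [map_add]; exact Submodule.add_mem _ hs ht
      | tmul P Q => exact h _ (planeIncl_mem q m P) _ (planeIncl_mem q n Q)

theorem mul_mem_planeHom {n : ℕ} {P Q : Plane q} (hP : P ∈ planeHom q 1)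
    (hQ : Q ∈ planeHom q n) : P * Q ∈ planeHom q (n + 1) := by
  obtain ⟨α, β, rfl⟩ := eq_of_mem_planeHom_one hP
  rw [add_mul, smul_mul_assoc, smul_mul_assoc]
  exact Submodule.add_mem _ (Submodule.smul_mem _ _ (planeX_mul_mem hQ))
    (Submodule.smul_mem _ _ (planeY_mul_mem hQ))

variable (q)

/-- `X` as a homogeneous polynomial of degree `1`. -/
def homX : PlaneHom q 1 :=
  (⟨planeX q, Submodule.subset_span ⟨1, 0, rfl, by simp⟩⟩ : planeHom q 1)

/-- `Y` as a homogeneous polynomial of degree `1`. -/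
def homY : PlaneHom q 1 :=
  (⟨planeY q, Submodule.subset_span ⟨0, 1, rfl, by simp⟩⟩ : planeHom q 1)

variable (n : ℕ)

/-- Multiplication by `X` on homogeneous polynomials. -/
def homMulX : PlaneHom q n →ₗ[ℂ] PlaneHom q (n + 1) :=
  homRestrict (LinearMap.mulLeft ℂ (planeX q)) fun _ ↦ planeX_mul_mem

/-- Multiplication by `Y` on homogeneous polynomials. -/
def homMulY : PlaneHom q n →ₗ[ℂ] PlaneHom q (n + 1) :=
  homRestrict (LinearMap.mulLeft ℂ (planeY q)) fun _ ↦ planeY_mul_mem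

/-- The partial derivative with respect to `X` on homogeneous polynomials. -/
def homDerivX : PlaneHom q (n + 1) →ₗ[ℂ] PlaneHom q n :=
  homRestrict (derivX q) fun _ h ↦ (deriv_mem h).1

/-- The partial derivative with respect to `Y` on homogeneous polynomials. -/
def homDerivY : PlaneHom q (n + 1) →ₗ[ℂ] PlaneHom q n :=
  homRestrict (derivY q) fun _ h ↦ (deriv_mem h).2

/-- The product of a linear form with a homogeneous polynomial. -/
def homMul : PlaneHom q 1 ⊗[ℂ] PlaneHom q n →ₗ[ℂ] PlaneHom q (n + 1) :=
  homLift (LinearMap.mul ℂ (Plane q)) fun _ hP _ hQ ↦ mul_mem_planeHom hP hQ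

/-- The contraction of a linear form with the gradient of a homogeneous polynomial. -/
def homContract : PlaneHom q 1 ⊗[ℂ] PlaneHom q (n + 1) →ₗ[ℂ] PlaneHom q n :=
  homLift (contract q) fun _ hP _ hQ ↦ contract_mem hP hQ

/-- The gradient `P ↦ X ⊗ ∂_X P + Y ⊗ ∂_Y P`. -/
def gradient : PlaneHom q (n + 1) →ₗ[ℂ] PlaneHom q 1 ⊗[ℂ] PlaneHom q n :=
  TensorProduct.mk ℂ _ _ (homX q) ∘ₗ homDerivX q n +
    TensorProduct.mk ℂ _ _ (homY q) ∘ₗ homDerivY q n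

/-- The map `R ↦ X ⊗ Y R - q⁻¹ Y ⊗ X R` into the kernel of the multiplication. -/
def syzygy : PlaneHom q n →ₗ[ℂ] PlaneHom q 1 ⊗[ℂ] PlaneHom q (n + 1) :=
  TensorProduct.mk ℂ _ _ (homX q) ∘ₗ homMulY q n -
    (q : ℂ)⁻¹ • (TensorProduct.mk ℂ _ _ (homY q) ∘ₗ homMulX q n)

variable {n}

theorem gradient_apply (P : PlaneHom q (n + 1)) :
    gradient q n P = homX q ⊗ₜ homDerivX q n P + homY q ⊗ₜ homDerivY q n P := rfl

theorem syzygy_apply (P : PlaneHom q n) :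
    syzygy q n P = homX q ⊗ₜ homMulY q n P - (q : ℂ)⁻¹ • (homY q ⊗ₜ homMulX q n P) := rfl

theorem planeIncl_homX : planeIncl q 1 (homX q) = planeX q := rfl

theorem planeIncl_homY : planeIncl q 1 (homY q) = planeY q := rfl

theorem planeIncl_homMulX (P : PlaneHom q n) :
    planeIncl q _ (homMulX q n P) = planeX q * planeIncl q n P := rfl

theorem planeIncl_homMulY (P : PlaneHom q n) :
    planeIncl q _ (homMulY q n P) = planeY q * planeIncl q n P := rfl

theorem planeIncl_homDerivX (P : PlaneHom q (n + 1)) :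
    planeIncl q _ (homDerivX q n P) = derivX q (planeIncl q _ P) := rfl

theorem planeIncl_homDerivY (P : PlaneHom q (n + 1)) :
    planeIncl q _ (homDerivY q n P) = derivY q (planeIncl q _ P) := rfl

theorem planeIncl_homMul (P : PlaneHom q 1) (Q : PlaneHom q n) :
    planeIncl q _ (homMul q n (P ⊗ₜ Q)) = planeIncl q 1 P * planeIncl q n Q := rfl

theorem planeIncl_homContract (P : PlaneHom q 1) (Q : PlaneHom q (n + 1)) :
    planeIncl q _ (homContract q n (P ⊗ₜ Q)) =
      contract q (planeIncl q 1 P) (planeIncl q _ Q) := rfl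

theorem contract_X (Q : Plane q) : contract q (planeX q) Q = derivY q Q := by
  simpa using contract_linear 1 0 Q

theorem contract_Y (Q : Plane q) : contract q (planeY q) Q = -((q : ℂ)⁻¹ • derivX q Q) := by
  simpa using contract_linear 0 1 Q

/-- The gradient is, up to the factor `[n+1]`, a section of the multiplication. -/
theorem homMul_gradient (P : PlaneHom q (n + 1)) :
    homMul q n (gradient q n P) = qInt q (n + 1) • P := by
  apply planeIncl_injective
  simp only [gradient_apply, map_add, map_smul, planeIncl_homMul, planeIncl_homX, planeIncl_homY,
    planeIncl_homDerivX, planeIncl_homDerivY]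
  exact euler (planeIncl_mem q _ P)

theorem homMul_syzygy (R : PlaneHom q n) : homMul q (n + 1) (syzygy q n R) = 0 := by
  apply planeIncl_injective
  simp only [syzygy_apply, map_sub, map_smul, map_zero, planeIncl_homMul, planeIncl_homX,
    planeIncl_homY, planeIncl_homMulX, planeIncl_homMulY, planeY_mul_planeX_mul, smul_smul,
    inv_mul_cancel₀ q.ne_zero, one_smul, sub_self]

theorem homContract_gradient (P : PlaneHom q (n + 1 + 1)) :
    homContract q n (gradient q (n + 1) P) = 0 := by
  apply planeIncl_injective
  simp only [gradient_apply, map_add, map_zero, planeIncl_homContract, planeIncl_homX,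
    planeIncl_homY, planeIncl_homDerivX, planeIncl_homDerivY, contract_X, contract_Y,
    derivX_derivY, smul_smul, inv_mul_cancel₀ q.ne_zero, one_smul, add_neg_cancel]

/-- The syzygy map is, up to the factor `q⁻² [n+2]`, a section of the contraction. -/
theorem homContract_syzygy (R : PlaneHom q n) :
    (q : ℂ) ^ 2 • homContract q n (syzygy q n R) = qInt q (n + 1 + 1) • R := by
  apply planeIncl_injective
  have hq := q.ne_zero
  have h := congrArg ((q : ℂ) ^ 4 • ·) (euler (planeIncl_mem q _ R))
  simp only [syzygy_apply, map_sub, map_smul, planeIncl_homContract, planeIncl_homX,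
    planeIncl_homY, planeIncl_homMulX, planeIncl_homMulY, contract_X, contract_Y, derivY_Y_mul,
    derivX_X_mul, qInt_succ]
  -- The goal is `(1 + q² + q⁴ [n]) R` with `q⁴ [n] R` expanded by the Euler identity.
  refine Eq.trans ?_ ((congrArg ((1 + (q : ℂ) ^ 2) • planeIncl q n R + ·) h).trans ?_)
  · match_scalars <;> field_simp <;> ring
  · module

theorem homMul_X (Q : PlaneHom q n) : homMul q n (homX q ⊗ₜ Q) = homMulX q n Q := rfl

theorem homMul_Y (Q : PlaneHom q n) : homMul q n (homY q ⊗ₜ Q) = homMulY q n Q := rfl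

theorem homContract_X (Q : PlaneHom q (n + 1)) :
    homContract q n (homX q ⊗ₜ Q) = homDerivY q n Q :=
  planeIncl_injective q n (contract_X q _)

theorem homContract_Y (Q : PlaneHom q (n + 1)) :
    homContract q n (homY q ⊗ₜ Q) = -((q : ℂ)⁻¹ • homDerivX q n Q) :=
  planeIncl_injective q n (contract_Y q _)

theorem homDerivX_homMulX (Q : PlaneHom q (n + 1)) : homDerivX q (n + 1) (homMulX q (n + 1) Q) =
    Q + (q : ℂ) ^ 2 • homMulX q n (homDerivX q n Q) :=
  planeIncl_injective q (n + 1) (derivX_X_mul _)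

theorem homDerivY_homMulX (Q : PlaneHom q (n + 1)) : homDerivY q (n + 1) (homMulX q (n + 1) Q) =
    (q : ℂ) • homMulX q n (homDerivY q n Q) :=
  planeIncl_injective q (n + 1) (derivY_X_mul _)

theorem homDerivX_homMulY (Q : PlaneHom q (n + 1)) : homDerivX q (n + 1) (homMulY q (n + 1) Q) =
    (q : ℂ) • homMulY q n (homDerivX q n Q) :=
  planeIncl_injective q (n + 1) (derivX_Y_mul _)

theorem homDerivY_homMulY (Q : PlaneHom q (n + 1)) : homDerivY q (n + 1) (homMulY q (n + 1) Q) =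
    Q + (q : ℂ) ^ 2 • homMulY q n (homDerivY q n Q) +
      ((q : ℂ) ^ 2 - 1) • homMulX q n (homDerivX q n Q) :=
  planeIncl_injective q (n + 1) (derivY_Y_mul _)

theorem hom_euler (Q : PlaneHom q (n + 1)) :
    homMulX q n (homDerivX q n Q) + homMulY q n (homDerivY q n Q) = qInt q (n + 1) • Q :=
  planeIncl_injective q (n + 1) (euler (planeIncl_mem q _ Q))

/-- The compositions of `homMul` with the gradient and of `homContract` with `q²` times the syzygy
map add up to the scalar `[n+2]`. -/
theorem gradient_homMul_add (t : PlaneHom q 1 ⊗[ℂ] PlaneHom q (n + 1)) :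
    gradient q (n + 1) (homMul q (n + 1) t) + (q : ℂ) ^ 2 • syzygy q n (homContract q n t) =
      qInt q (n + 1 + 1) • t := by
  have hq := q.ne_zero
  induction t using TensorProduct.induction_on with
  | zero => simp
  | add s t hs ht => simp only [map_add, smul_add, ← hs, ← ht]; abel
  | tmul P Q =>
    have hX : gradient q (n + 1) (homMul q (n + 1) (homX q ⊗ₜ Q)) +
        (q : ℂ) ^ 2 • syzygy q n (homContract q n (homX q ⊗ₜ Q)) =
          qInt q (n + 1 + 1) • (homX q ⊗ₜ Q) := by
      rw [homMul_X, homContract_X, gradient_apply, homDerivX_homMulX, homDerivY_homMulX, qInt_succ,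
        add_smul, mul_smul, ← TensorProduct.tmul_smul (qInt q (n + 1)), ← hom_euler]
      simp only [syzygy_apply, TensorProduct.tmul_add, TensorProduct.tmul_smul]
      match_scalars <;> field_simp <;> ring
    have hY : gradient q (n + 1) (homMul q (n + 1) (homY q ⊗ₜ Q)) +
        (q : ℂ) ^ 2 • syzygy q n (homContract q n (homY q ⊗ₜ Q)) =
          qInt q (n + 1 + 1) • (homY q ⊗ₜ Q) := by
      rw [homMul_Y, homContract_Y, gradient_apply, homDerivX_homMulY, homDerivY_homMulY, qInt_succ,
        add_smul, mul_smul, ← TensorProduct.tmul_smul (qInt q (n + 1)), ← hom_euler]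
      simp only [map_neg, map_smul, syzygy_apply, TensorProduct.tmul_add, TensorProduct.tmul_smul]
      match_scalars <;> field_simp <;> ring
    -- Both sides are linear in `P`, so the cases `P = X` and `P = Y` suffice.
    obtain ⟨α, β, h⟩ := eq_of_mem_planeHom_one (planeIncl_mem q 1 P)
    obtain rfl : P = α • homX q + β • homY q := planeIncl_injective q 1 h
    simp only [TensorProduct.add_tmul, ← TensorProduct.smul_tmul', map_add, map_smul]
    refine Eq.trans ?_ ((congrArg₂ (α • · + β • ·) hX hY).trans ?_) <;> module

/-- The isomorphism `P ⊗ Q ↦ (P Q, contract P Q)` from linear forms tensor polynomials of degree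
`n + 1` to polynomials of degree `n + 2` plus polynomials of degree `n`. Its inverse is built from
the gradient and the syzygy map. -/
def clebschGordan (hq : qInt q (n + 1 + 1) ≠ 0) :
    PlaneHom q 1 ⊗[ℂ] PlaneHom q (n + 1) ≃ₗ[ℂ] PlaneHom q (n + 1 + 1) × PlaneHom q n :=
  LinearEquiv.ofLinearMap ((homMul q (n + 1)).prod (homContract q n))
    ((qInt q (n + 1 + 1))⁻¹ • (gradient q (n + 1)).coprod ((q : ℂ) ^ 2 • syzygy q n))
    (by
      refine LinearMap.ext fun ⟨P, R⟩ ↦ Prod.ext ?_ ?_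
      · change homMul q (n + 1) ((qInt q (n + 1 + 1))⁻¹ •
          (gradient q (n + 1) P + (q : ℂ) ^ 2 • syzygy q n R)) = P
        rw [map_smul, map_add, map_smul, homMul_gradient, homMul_syzygy, smul_zero, add_zero,
          inv_smul_smul₀ hq]
      · change homContract q n ((qInt q (n + 1 + 1))⁻¹ •
          (gradient q (n + 1) P + (q : ℂ) ^ 2 • syzygy q n R)) = R
        rw [map_smul, map_add, map_smul, homContract_gradient, homContract_syzygy, zero_add,
          inv_smul_smul₀ hq])
    (by
      refine LinearMap.ext fun t ↦ ?_
      change (qInt q (n + 1 + 1))⁻¹ • (gradient q (n + 1) (homMul q (n + 1) t) +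
        (q : ℂ) ^ 2 • syzygy q n (homContract q n t)) = t
      rw [gradient_homMul_add, inv_smul_smul₀ hq])

theorem clebschGordan_apply (hq : qInt q (n + 1 + 1) ≠ 0)
    (t : PlaneHom q 1 ⊗[ℂ] PlaneHom q (n + 1)) :
    clebschGordan q hq t = (homMul q (n + 1) t, homContract q n t) := rfl

/-! ### Equivariance of the decomposition -/

/-- The first component of the extended isomorphism is the product in the quantum `𝒜`-plane. -/
theorem homIncl_extendIso_fst (hq : qInt q (n + 1 + 1) ≠ 0) (s : HomPart q 𝒜 1)
    (t : HomPart q 𝒜 (n + 1)) :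
    homIncl q 𝒜 (n + 1 + 1) (extendIso 𝒜 (clebschGordan q hq) (btmul 𝒜 s t)).1 =
      homIncl q 𝒜 1 s * homIncl q 𝒜 (n + 1) t := by
  induction s using TensorProduct.induction_on with
  | zero => simp [btmul]
  | add s s' hs hs' =>
    simp only [btmul, TensorProduct.add_tmul, map_add, Prod.fst_add, add_mul] at hs hs' ⊢
    rw [hs, hs']
  | tmul x P =>
    induction t using TensorProduct.induction_on with
    | zero => simp [btmul]
    | add t t' ht ht' =>
      simp only [btmul, TensorProduct.tmul_add, map_add, Prod.fst_add, mul_add] at ht ht' ⊢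
      rw [ht, ht']
    | tmul y Q =>
      rw [extendIso_btmul, clebschGordan_apply]
      simp only [homIncl_tmul, planeIncl_homMul, Algebra.TensorProduct.tmul_mul_tmul]

/-- The second component of the extended isomorphism is the contraction, computed in the quantum
`𝒜`-plane. -/
theorem homIncl_extendIso_snd (hq : qInt q (n + 1 + 1) ≠ 0) (s : HomPart q 𝒜 1)
    (t : HomPart q 𝒜 (n + 1)) :
    homIncl q 𝒜 n (extendIso 𝒜 (clebschGordan q hq) (btmul 𝒜 s t)).2 =
      extDerivX q 𝒜 (homIncl q 𝒜 1 s) * extDerivY q 𝒜 (homIncl q 𝒜 (n + 1) t) -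
        (q : ℂ)⁻¹ •
          (extDerivY q 𝒜 (homIncl q 𝒜 1 s) * extDerivX q 𝒜 (homIncl q 𝒜 (n + 1) t)) := by
  induction s using TensorProduct.induction_on with
  | zero => simp [btmul]
  | add s s' hs hs' =>
    simp only [btmul, TensorProduct.add_tmul, map_add, Prod.snd_add, add_mul, smul_add] at hs hs' ⊢
    rw [hs, hs']
    abel
  | tmul x P =>
    induction t using TensorProduct.induction_on with
    | zero => simp [btmul]
    | add t t' ht ht' =>
      simp only [btmul, TensorProduct.tmul_add, map_add, Prod.snd_add, mul_add, smul_add]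
        at ht ht' ⊢
      rw [ht, ht']
      abel
    | tmul y Q =>
      rw [extendIso_btmul, clebschGordan_apply]
      simp only [homIncl_tmul, planeIncl_homContract, contract_apply, extDerivX_tmul,
        extDerivY_tmul, Algebra.TensorProduct.tmul_mul_tmul, TensorProduct.tmul_sub,
        TensorProduct.tmul_smul]

variable {q} in
theorem Point.homIncl_rhoHom_one_tmul (A : Point q 𝒜) (P : PlaneHom q n) :
    homIncl q 𝒜 n (A.rhoHom n (1 ⊗ₜ P)) = A.subst (planeIncl q n P) := by
  rw [A.coe_rhoHom, homIncl_tmul, A.rho_tmul, one_smul]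

variable {q} in
/-- On pure tensors `(1 ⊗ P) ⊗ (1 ⊗ Q)` equivariance amounts to the compatibility of the
substitution with products and with contraction. -/
theorem Point.extendIso_clebschGordan (A : Point q 𝒜) (hq : qInt q (n + 1 + 1) ≠ 0)
    (P : PlaneHom q 1) (Q : PlaneHom q (n + 1)) :
    extendIso 𝒜 (clebschGordan q hq)
        (btmul 𝒜 (A.rhoHom 1 (1 ⊗ₜ P)) (A.rhoHom (n + 1) (1 ⊗ₜ Q))) =
      (A.rhoHom (n + 1 + 1)).prodMap (A.rhoHom n)
        (extendIso 𝒜 (clebschGordan q hq) (btmul 𝒜 (1 ⊗ₜ P) (1 ⊗ₜ Q))) := by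
  rw [extendIso_btmul 𝒜 _ 1 1 P Q, mul_one, LinearMap.prodMap_apply]
  refine Prod.ext (homIncl_injective q 𝒜 _ ?_) (homIncl_injective q 𝒜 _ ?_)
  · rw [homIncl_extendIso_fst, A.homIncl_rhoHom_one_tmul, A.homIncl_rhoHom_one_tmul,
      A.homIncl_rhoHom_one_tmul, ← map_mul, clebschGordan_apply, planeIncl_homMul]
  · rw [homIncl_extendIso_snd, A.homIncl_rhoHom_one_tmul, A.homIncl_rhoHom_one_tmul,
      A.homIncl_rhoHom_one_tmul, A.subst_contract (planeIncl_mem q 1 P), clebschGordan_apply,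
      planeIncl_homContract]

/-- Two `𝒜`-linear maps on `(𝒜 ⊗ V) ⊗_𝒜 (𝒜 ⊗ W)` agree if they agree on the elements that come
from `V` and `W`. -/
theorem BalancedTensor.hom_ext {V W M : Type*} [AddCommGroup V] [Module ℂ V] [AddCommGroup W]
    [Module ℂ W] [AddCommGroup M] [Module 𝒜 M]
    {f g : BalancedTensor 𝒜 (𝒜 ⊗[ℂ] V) (𝒜 ⊗[ℂ] W) →ₗ[𝒜] M}
    (h : ∀ (v : V) (w : W), f (btmul 𝒜 (1 ⊗ₜ v) (1 ⊗ₜ w)) = g (btmul 𝒜 (1 ⊗ₜ v) (1 ⊗ₜ w))) :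
    f = g := by
  refine LinearMap.ext fun t ↦ ?_
  rw [← spread_collect 𝒜 t]
  generalize collect 𝒜 V W t = u
  induction u using TensorProduct.induction_on with
  | zero => simp only [map_zero]
  | add u u' hu hu' => simp only [map_add, hu, hu']
  | tmul x p =>
    induction p using TensorProduct.induction_on with
    | zero => simp only [TensorProduct.tmul_zero, map_zero]
    | add p p' hp hp' => simp only [TensorProduct.tmul_add, map_add, hp, hp']
    | tmul v w =>
      change f (x • btmul 𝒜 (1 ⊗ₜ v) (1 ⊗ₜ w)) = g (x • btmul 𝒜 (1 ⊗ₜ v) (1 ⊗ₜ w))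
      rw [map_smul, map_smul, h]

end QuantumSL2

end

theorem mainTheorem3 (q : ℂˣ) (n : ℕ) (hn : 1 ≤ n)
    (hq : ∑ j ∈ Finset.range (n + 1), (q : ℂ) ^ (2 * j) ≠ 0) :
    ∃ φ : QuantumSL2.PlaneHom q 1 ⊗[ℂ] QuantumSL2.PlaneHom q n ≃ₗ[ℂ]
        QuantumSL2.PlaneHom q (n + 1) × QuantumSL2.PlaneHom q (n - 1),
      ∀ (𝒜 : Type*) [Ring 𝒜] [Algebra ℂ 𝒜] (A : QuantumSL2.Point q 𝒜)
        (t : QuantumSL2.BalancedTensor 𝒜 (QuantumSL2.HomPart q 𝒜 1) (QuantumSL2.HomPart q 𝒜 n)),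
        QuantumSL2.extendIso 𝒜 φ (QuantumSL2.tensorMap (A.rhoHom 1) (A.rhoHom n) t) =
          (A.rhoHom (n + 1)).prodMap (A.rhoHom (n - 1)) (QuantumSL2.extendIso 𝒜 φ t) := by
  -- A positive degree is written `n + 1`, so that the truncated `n - 1` becomes a variable.
  obtain _ | n := n
  · omega
  · refine ⟨QuantumSL2.clebschGordan q hq, fun 𝒜 _ _ A t ↦ ?_⟩
    refine LinearMap.congr_fun (f := (QuantumSL2.extendIso 𝒜 _).toLinearMap ∘ₗ
        QuantumSL2.tensorMap (A.rhoHom 1) (A.rhoHom (n + 1)))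
      (g := (A.rhoHom (n + 1 + 1)).prodMap (A.rhoHom n) ∘ₗ
        (QuantumSL2.extendIso 𝒜 _).toLinearMap)
      (QuantumSL2.BalancedTensor.hom_ext fun P Q ↦ ?_) t
    rw [LinearMap.comp_apply, QuantumSL2.tensorMap_btmul]
    exact A.extendIso_clebschGordan hq P Q
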